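/- **Setting.** A graph is a finite loopless directed multigraph $G=(V,E)$ ($E$ a multiset); the degree of a vertex is in-degree plus out-degree, with multiplicity, and $G$ is $D$-bounded if all degrees are at most $D$. A $k$-colored graph is a pair $(G,\chi)$ with $\chi:V\to[k]$ a proper coloring. Paths ignore directions. For an edge $e=(u,v)$, $B_G^{\ell}(e)$ is the set of vertices joined to $u$ or $v$ by a path of length at most $\ell$. A *type* is an isomorphism class of doubly rooted $k$-colored graphs $(G,\chi,e)$, $e\in E$ (isomorphisms preserve edge multiplicities, colors and the root edge). $\mathcal T_{k,\ell,D}$ is the (finite) set of types of $D$-bounded doubly rooted $k$-colored graphs in which every vertex lies in $B^{\ell}(e)$. The radius-$\ell$ neighborhood type of $e$ in $(G,\chi)$ is the type of $(G[N],\chi|_N,e)$, where $N=B_G^\ell(e)$. Let $\ell\ge 1$. Given an ordering $\sigma$ of $E$ (with multiplicity), the radius-$\ell$ *visible neighborhood* of $e=(u,v)$ is the graph $(\overline V,\overline E)$ obtained by starting from $\overline V=\{u,v\}$, $\overline E=\emptyset$ and, for $i=1,\dots,|E|$, adding $\sigma(i)$ to $\overline E$ and its endpoints to $\overline V$ whenever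 $\sigma(i)$ has an endpoint in $B_{(\overline V,\overline E)}^{\ell-1}(e)$; its type (with $\chi|_{\overline V}$ and root $e$) is the *visible type* of $e$ given $\sigma$. For a type $T$ with representative $(G',\chi',e')$, $\mathsf{Vis}(T)$ is the distribution of the visible type of $e'$ given a uniformly random ordering of the edges of $G'$. The *visible edge neighborhood-type distribution* $\mathsf{EdgeVis}_{G,\chi}^{\ell}$ of a $k$-colored graph with $E\ne\emptyset$ is obtained by drawing $e\in E$ uniformly (with multiplicity), taking the radius-$\ell$ neighborhood type $T$ of $e$, and sampling from $\mathsf{Vis}(T)$. The total variation distance is $\mathrm{tv}(P,Q)=\frac12\sum_T|P(T)-Q(T)|$. **Theorem.** For all $k,\ell,D\in\mathbb N$ with $\ell\ge1$ and all real $\epsilon,\delta>0$ there are a constant $C$ (depending only on $k,\ell,D,\epsilon,\delta$) and a single (deterministic) one-pass streaming algorithm such that the following holds for every $n$ and every $D$-bounded $k$-colored graph $(G=([n],E),\chi:[n]\to[k])$ with $E\neq\emptyset$. Given $n$, black-box access to $\chi$, and one pass over the edges of $G$ in any order, the algorithm halts, uses at most $C\log n$ bits of memory throughout, and outputs a probability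 distribution $\mathcal D$ on $\mathcal T_{k,\ell,D}$; and if the order of the edges is uniformly random, then, except with probability at most $\delta$, $$\mathrm{tv}\bigl(\mathcal D,\mathsf{EdgeVis}_{G,\chi}^{\ell}\bigr)\le\epsilon .$$ -/

import Mathlib

namespace DicutStream

/-! ### Directed multigraphs -/

/-- A directed edge `(src, dst)` without self-loops; vertices are labelled by natural numbers. -/
@[ext]
structure Edge where
  src : ℕ
  dst : ℕ
  ne : src ≠ dst
  deriving DecidableEq

/-- The image of an edge under a relabelling of the vertices. -/
def Edge.map (φ : Equiv.Perm ℕ) (e : Edge) : Edge :=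
  ⟨φ e.src, φ e.dst, fun h => e.ne (φ.injective h)⟩

/-- A finite loopless directed multigraph: a finite set of vertices and a multiset of edges. -/
@[ext]
structure DiMultigraph where
  verts : Finset ℕ
  edges : Multiset Edge
  src_mem : ∀ e ∈ edges, e.src ∈ verts
  dst_mem : ∀ e ∈ edges, e.dst ∈ verts

namespace DiMultigraph

/-- The total degree of `v`: in-degree plus out-degree, with multiplicity. -/
def degree (G : DiMultigraph) (v : ℕ) : ℕ :=
  G.edges.countP (fun e => e.dst = v) + G.edges.countP (fun e => e.src = v)

/-- `G` is `D`-bounded: its maximum degree is at most `D`. -/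
def IsBounded (G : DiMultigraph) (D : ℕ) : Prop := ∀ v ∈ G.verts, G.degree v ≤ D

/-- `χ` is a proper coloring of `G` (only the values of `χ` on the vertices of `G` matter). -/
def IsProperColoring {k : ℕ} (G : DiMultigraph) (χ : ℕ → Fin k) : Prop :=
  ∀ e ∈ G.edges, χ e.src ≠ χ e.dst

/-- Adjacency in `G`, ignoring directions and multiplicities. -/
def underlying (G : DiMultigraph) : SimpleGraph ℕ where
  Adj u v := ∃ e ∈ G.edges, (e.src = u ∧ e.dst = v) ∨ (e.src = v ∧ e.dst = u)
  symm := ⟨fun _ _ ⟨e, he, h⟩ => ⟨e, he, h.symm⟩⟩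
  loopless := ⟨fun _ ⟨e, _, h⟩ => by
    rcases h with ⟨h1, h2⟩ | ⟨h1, h2⟩ <;> exact e.ne (h1.trans h2.symm)⟩

open Classical in
/-- The radius-`l` ball around the vertex `v`: the vertices joined to `v` by a path
(ignoring directions) of length at most `l`. -/
noncomputable def ball (G : DiMultigraph) (l : ℕ) (v : ℕ) : Finset ℕ :=
  G.verts.filter (fun w => ∃ p : G.underlying.Walk w v, p.length ≤ l)

/-- The radius-`l` ball around an edge: the union of the balls around its endpoints. -/
noncomputable def edgeBall (G : DiMultigraph) (l : ℕ) (e : Edge) : Finset ℕ :=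
  G.ball l e.src ∪ G.ball l e.dst

/-- The induced subgraph of `G` on the vertices in `U`. -/
def induce (G : DiMultigraph) (U : Finset ℕ) : DiMultigraph where
  verts := G.verts ∩ U
  edges := G.edges.filter (fun e => e.src ∈ U ∧ e.dst ∈ U)
  src_mem e he := by
    rw [Multiset.mem_filter] at he
    exact Finset.mem_inter.2 ⟨G.src_mem e he.1, he.2.1⟩
  dst_mem e he := by
    rw [Multiset.mem_filter] at he
    exact Finset.mem_inter.2 ⟨G.dst_mem e he.1, he.2.2⟩

/-- The graph consisting of the two endpoints of `e` and no edges. -/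
def endpoints (e : Edge) : DiMultigraph where
  verts := {e.src, e.dst}
  edges := 0
  src_mem f hf := absurd hf (Multiset.notMem_zero f)
  dst_mem f hf := absurd hf (Multiset.notMem_zero f)

/-- Add one copy of the edge `f`, together with its endpoints, to `G`. -/
def addEdge (G : DiMultigraph) (f : Edge) : DiMultigraph where
  verts := insert f.src (insert f.dst G.verts)
  edges := f ::ₘ G.edges
  src_mem e he := by
    rcases Multiset.mem_cons.1 he with rfl | h
    · simp
    · simp [G.src_mem e h]
  dst_mem e he := by
    rcases Multiset.mem_cons.1 he with rfl | h
    · simp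
    · simp [G.dst_mem e h]

end DiMultigraph

/-! ### Orderings and visible neighborhoods -/

/-- The set of orderings of a multiset of edges (with multiplicity). -/
def orderings (E : Multiset Edge) : Finset (List Edge) := (Multiset.lists E).toFinset

theorem mem_orderings {E : Multiset Edge} {σ : List Edge} :
    σ ∈ orderings E ↔ (σ : Multiset Edge) = E := by
  rw [orderings, Multiset.mem_toFinset, Multiset.mem_lists_iff]
  exact eq_comm

theorem orderings_nonempty (E : Multiset Edge) : (orderings E).Nonempty :=
  ⟨E.toList, mem_orderings.2 E.coe_toList⟩

/-- The uniform distribution on the orderings of `E`. -/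
noncomputable def uniformOrdering (E : Multiset Edge) : PMF (List Edge) :=
  PMF.uniformOfFinset (orderings E) (orderings_nonempty E)

/-- One step of the greedy exploration from the edge `e`: the next edge `f` of the stream is
recorded iff one of its endpoints is within distance `l - 1` of `e` in the graph built so far. -/
noncomputable def visStep (l : ℕ) (e : Edge) (H : DiMultigraph) (f : Edge) : DiMultigraph :=
  if f.src ∈ H.edgeBall (l - 1) e ∨ f.dst ∈ H.edgeBall (l - 1) e then H.addEdge f else H

/-- The radius-`l` visible neighborhood of `e` given the ordering `σ` (meaningful for `1 ≤ l`). -/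
noncomputable def visNbhd (l : ℕ) (e : Edge) (σ : List Edge) : DiMultigraph :=
  σ.foldl (visStep l e) (DiMultigraph.endpoints e)

/-! ### Types of doubly rooted colored graphs -/

/-- A graph with a vertex coloring and a distinguished (root) edge.
The color of a natural number that is not a vertex is irrelevant. -/
structure RootedGraph (k : ℕ) where
  graph : DiMultigraph
  color : ℕ → Fin k
  root : Edge

/-- The triple is a doubly rooted properly `k`-colored graph. -/
def RootedGraph.IsDoublyRooted {k : ℕ} (X : RootedGraph k) : Prop :=
  X.root ∈ X.graph.edges ∧ X.graph.IsProperColoring X.color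

/-- Isomorphism. Every bijection between two finite sets of natural numbers extends to a
permutation of `ℕ`, so the bijection of the vertex sets is given as such a permutation. -/
def RootedGraph.Iso {k : ℕ} (X Y : RootedGraph k) : Prop :=
  ∃ φ : Equiv.Perm ℕ,
    X.graph.verts.map φ.toEmbedding = Y.graph.verts ∧
    X.graph.edges.map (Edge.map φ) = Y.graph.edges ∧
    (∀ v ∈ X.graph.verts, X.color v = Y.color (φ v)) ∧
    Edge.map φ X.root = Y.root

theorem RootedGraph.iso_equivalence (k : ℕ) : Equivalence (@RootedGraph.Iso k) where
  refl X := ⟨Equiv.refl ℕ, by simp, by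
    rw [show Edge.map (Equiv.refl ℕ) = id from rfl, Multiset.map_id], by simp, rfl⟩
  symm := by
    rintro X Y ⟨φ, h1, h2, h3, h4⟩
    have hid : ∀ e : Edge, Edge.map φ.symm (Edge.map φ e) = e := fun e => by
      ext <;> simp [Edge.map]
    refine ⟨φ.symm, ?_, ?_, ?_, ?_⟩
    · rw [← h1]; ext; simp
    · rw [← h2, Multiset.map_map]; simp [hid]
    · intro v hv
      rw [← h1] at hv
      obtain ⟨w, hw, rfl⟩ := Finset.mem_map.1 hv
      simpa using (h3 w hw).symm
    · rw [← h4, hid]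
  trans := by
    rintro X Y Z ⟨φ, h1, h2, h3, h4⟩ ⟨ψ, g1, g2, g3, g4⟩
    refine ⟨φ.trans ψ, ?_, ?_, ?_, ?_⟩
    · rw [← g1, ← h1, Finset.map_map]; rfl
    · rw [← g2, ← h2, Multiset.map_map]; rfl
    · intro v hv
      rw [h3 v hv, g3 (φ v) (h1 ▸ Finset.mem_map_of_mem _ hv)]; rfl
    · rw [← g4, ← h4]; rfl

instance rootedGraphSetoid (k : ℕ) : Setoid (RootedGraph k) :=
  ⟨RootedGraph.Iso, RootedGraph.iso_equivalence k⟩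

/-- Isomorphism classes. -/
abbrev GraphType (k : ℕ) : Type := Quotient (rootedGraphSetoid k)

/-- The isomorphism class of `(G, χ, e)`. -/
def typeOf {k : ℕ} (G : DiMultigraph) (χ : ℕ → Fin k) (e : Edge) : GraphType k :=
  Quotient.mk (rootedGraphSetoid k) ⟨G, χ, e⟩

/-- The (finite) set of isomorphism classes of `D`-bounded doubly rooted properly `k`-colored
graphs in which every vertex is within distance `l` of one of the roots. -/
def boundedTypes (k l D : ℕ) : Set (GraphType k) :=
  {T | ∃ X : RootedGraph k, typeOf X.graph X.color X.root = T ∧ X.IsDoublyRooted ∧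
    X.graph.IsBounded D ∧ ∀ v ∈ X.graph.verts, v ∈ X.graph.edgeBall l X.root}

/-- The radius-`l` neighborhood type of the edge `e` of the colored graph `(G, χ)`. -/
noncomputable def nbhdType {k : ℕ} (G : DiMultigraph) (χ : ℕ → Fin k) (l : ℕ) (e : Edge) :
    GraphType k :=
  typeOf (G.induce (G.edgeBall l e)) χ e

/-- The radius-`l` visible neighborhood type of `e` given the ordering `σ` of the edges. -/
noncomputable def visType {k : ℕ} (χ : ℕ → Fin k) (σ : List Edge) (l : ℕ) (e : Edge) :
    GraphType k :=
  typeOf (visNbhd l e σ) χ e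

/-! ### Distributions of types -/

/-- The edge neighborhood-type distribution: the type of a uniformly random edge. -/
noncomputable def edgeDist {k : ℕ} (G : DiMultigraph) (χ : ℕ → Fin k) (l : ℕ)
    (hE : G.edges ≠ 0) : PMF (GraphType k) :=
  (PMF.ofMultiset G.edges hE).map (nbhdType G χ l)

/-- The visible type distribution of a type `T`: pick a representative `(G, χ, e)` of `T`, draw a
uniformly random ordering of its edges, output the visible type of `e`. -/
noncomputable def visTypeDist {k : ℕ} (l : ℕ) (T : GraphType k) : PMF (GraphType k) :=
  (uniformOrdering T.out.graph.edges).map (fun σ => visType T.out.color σ l T.out.root)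

/-- The visible edge neighborhood-type distribution of the colored graph `(G, χ)`. -/
noncomputable def edgeVisDist {k : ℕ} (G : DiMultigraph) (χ : ℕ → Fin k) (l : ℕ)
    (hE : G.edges ≠ 0) : PMF (GraphType k) :=
  (edgeDist G χ l hE).bind (visTypeDist l)

/-- Total variation distance of two discrete distributions. -/
noncomputable def tvDist {α : Type} (P Q : PMF α) : ℝ :=
  (1 / 2) * ∑' a, |(P a).toReal - (Q a).toReal|

/-! ### One-pass streaming algorithms

The machine model is a register machine with a fixed finite control and a fixed finite number of
registers holding natural numbers; the same machine is used for all inputs, of all sizes.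
It has one-way, read-once access to the stream of edges and black-box access to the coloring.
Its space is the number of bits needed to write down the contents of all registers and the control
state, and it is measured after every elementary step. -/

/-- A value that can be assigned to a register (`sub` is truncated subtraction). -/
inductive Expr (R : Type) : Type
  | const (c : ℕ) : Expr R
  | reg (i : R) : Expr R
  | add (i j : R) : Expr R
  | sub (i j : R) : Expr R

/-- The value of an expression, given the contents of the registers. -/
def Expr.eval {R : Type} (m : R → ℕ) : Expr R → ℕ
  | .const c => c
  | .reg i => m i
  | .add i j => m i + m j
  | .sub i j => m i - m j

/-- What the machine does in one step: a simultaneous assignment to all registers, after which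
control passes to `next`; or an attempt to read the next edge of the stream, after which control
passes to `got` if there was one (now in the edge registers) and to `eos` at the end of the stream;
or halting. -/
inductive Command (Q R : Type) : Type
  | assign (f : R → Expr R) (next : Q) : Command Q R
  | read (got eos : Q) : Command Q R
  | halt : Command Q R

/-- A deterministic one-pass streaming machine for edge streams of `k`-colored graphs, which outputs
a probability distribution on the finite set `T`. The command depends on the control state, on the
results of all comparisons between two registers, and on the colors of the vertices whose names are
in the registers. -/
structure StreamMachine (k : ℕ) (T : Type) where
  /-- control states -/
  Q : Type
  /-- registers -/
  R : Type
  [finQ : Fintype Q]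
  [finR : Fintype R]
  [decR : DecidableEq R]
  start : Q
  /-- holds the number of vertices at the start -/
  sizeReg : R
  /-- the registers into which the endpoints of the next edge are read -/
  srcReg : R
  dstReg : R
  /-- the register that holds, in the end, the (unnormalized) output weight of an element of `T` -/
  outReg : T → R
  program : Q → (R → R → Bool) → (R → Option (Fin k)) → Command Q R

attribute [instance] StreamMachine.finQ StreamMachine.finR StreamMachine.decR

namespace StreamMachine

variable {k : ℕ} {T : Type}

/-- A configuration: control state, contents of the registers, unread part of the stream. -/
structure Config (M : StreamMachine k T) where
  state : M.Q
  mem : M.R → ℕ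
  rest : List Edge

/-- At the start all registers are `0`, except for the one that holds the number of vertices. -/
def init (M : StreamMachine k T) (n : ℕ) (σ : List Edge) : M.Config where
  state := M.start
  mem := Function.update (fun _ => 0) M.sizeReg n
  rest := σ

/-- One step on a graph with vertex set `{1, …, n}` and coloring `χ`; `none` if the machine has
halted. -/
def step (M : StreamMachine k T) (n : ℕ) (χ : ℕ → Fin k) (c : M.Config) : Option M.Config :=
  match M.program c.state (fun i j => decide (c.mem i ≤ c.mem j))
      (fun i => if 1 ≤ c.mem i ∧ c.mem i ≤ n then some (χ (c.mem i)) else none) with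
  | .assign f next => some ⟨next, fun i => (f i).eval c.mem, c.rest⟩
  | .read got eos =>
    match c.rest with
    | [] => some ⟨eos, c.mem, []⟩
    | e :: σ => some ⟨got,
        Function.update (Function.update c.mem M.srcReg e.src) M.dstReg e.dst, σ⟩
  | .halt => none

/-- The number of bits of memory that a configuration occupies. -/
def space (M : StreamMachine k T) (c : M.Config) : ℕ :=
  (Fintype.card M.Q).size + ∑ i, (c.mem i).size

/-- On the number of vertices `n`, the coloring `χ` and the stream `σ`, the machine halts and never
uses more than `s` bits of memory. -/
def HaltsInSpace (M : StreamMachine k T) (n : ℕ) (χ : ℕ → Fin k) (σ : List Edge) (s : ℝ) : Prop :=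
  (StateTransition.eval (M.step n χ) (M.init n σ)).Dom ∧
    ∀ c, StateTransition.Reaches (M.step n χ) (M.init n σ) c → (M.space c : ℝ) ≤ s

/-- The machine halts with output distribution `P`: the output weights in the final configuration
are proportional to `P`. (As `P` has total mass one, the weights cannot all be zero.) -/
def Outputs (M : StreamMachine k T) (n : ℕ) (χ : ℕ → Fin k) (σ : List Edge) (P : PMF T) : Prop :=
  ∃ c ∈ StateTransition.eval (M.step n χ) (M.init n σ),
    ∀ t, P t = (c.mem (M.outReg t) : ENNReal) / ∑' t', (c.mem (M.outReg t') : ENNReal)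

end StreamMachine

end DicutStream

namespace DicutStream

/-! ### Balls -/

namespace DiMultigraph

/-! The machine stores the first `N` edges and, after that, every edge that the exploration from one
of the first `s` edges records. If the stream has fewer than `N` edges, it is stored completely and
the exact distribution is computed. Otherwise the output is the empirical distribution of the
visible types of the first `s` edges. A discarded edge touches none of these explorations, so they
can be replayed from the stored list (`visNbhd_store`). Each of them records boundedly many edges,
so the storage is bounded (`length_store_le`).

In a random ordering the first `s` edges are a sample without replacement. The danger is that the
event "`e` is at position `i`" might bias the visible type of `e`. It does not: copies of `e` are
always recorded and do not change the balls around `e`, so, the number of copies of `e` being fixed,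
the visible neighborhood depends only on the order of the other edges inside the ball
(`visNbhd_congr`). Permuting those edges among their own positions moves no copy of `e`, and
`sum_mul_filter` turns this into independence. So every position is an unbiased sample of the target
distribution (`sum_hit`, `edgeVisDist_toReal`). If two edges have disjoint balls, the same argument,
used twice, makes their types jointly independent of their positions (`sum_pair_far`). By bounded
degree only boundedly many edges are near a given one, so with `m` edges the covariances are O(1/m)
and the variance of a frequency is at most 1/s + O(1/m) (`sum_freq_sub_sq_le`). Chebyshev's
inequality and a union bound over the finitely many types finish the probabilistic part.

A finite control can carry this out because the storage rule and the output weights are invariant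
under relabelling. They are therefore functions of the comparisons between registers, together with
colors in the case of the weights (`keepCode_iff`, `weight_eq`). Every register is bounded by `n`
plus a constant, which gives logarithmic space (`exists_storeMachine`). -/

theorem adj_iff {G : DiMultigraph} {u v : ℕ} : G.underlying.Adj u v ↔
    ∃ e ∈ G.edges, (e.src = u ∧ e.dst = v) ∨ (e.src = v ∧ e.dst = u) := Iff.rfl

theorem mem_verts_of_adj {G : DiMultigraph} {u v : ℕ} (h : G.underlying.Adj u v) :
    u ∈ G.verts := by
  obtain ⟨e, he, ⟨rfl, _⟩ | ⟨_, rfl⟩⟩ := h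
  · exact G.src_mem e he
  · exact G.dst_mem e he

theorem mem_ball {G : DiMultigraph} {l v w : ℕ} :
    w ∈ G.ball l v ↔ w ∈ G.verts ∧ ∃ p : G.underlying.Walk w v, p.length ≤ l := by
  simp [ball]

theorem mem_ball_zero {G : DiMultigraph} {v w : ℕ} :
    w ∈ G.ball 0 v ↔ w ∈ G.verts ∧ w = v := by
  rw [mem_ball]
  refine and_congr_right fun _ => ⟨fun ⟨p, hp⟩ => ?_, ?_⟩
  · exact SimpleGraph.Walk.eq_of_length_eq_zero (Nat.le_zero.1 hp)
  · rintro rfl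
    exact ⟨SimpleGraph.Walk.nil, le_rfl⟩

theorem mem_ball_succ {G : DiMultigraph} {l v w : ℕ} :
    w ∈ G.ball (l + 1) v ↔ w ∈ G.ball l v ∨ ∃ u ∈ G.ball l v, G.underlying.Adj w u := by
  constructor
  · intro h
    obtain ⟨hw, p, hp⟩ := mem_ball.1 h
    cases p with
    | nil => exact Or.inl (mem_ball.2 ⟨hw, SimpleGraph.Walk.nil, by simp⟩)
    | cons ha q =>
      refine Or.inr ⟨_, mem_ball.2 ⟨mem_verts_of_adj ha.symm, q, ?_⟩, ha⟩
      simpa using hp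
  · rintro (h | ⟨u, hu, ha⟩)
    · obtain ⟨hw, p, hp⟩ := mem_ball.1 h
      exact mem_ball.2 ⟨hw, p, by omega⟩
    · obtain ⟨_, p, hp⟩ := mem_ball.1 hu
      exact mem_ball.2 ⟨mem_verts_of_adj ha, SimpleGraph.Walk.cons ha p, by simpa using hp⟩

theorem mem_ball_comm {G : DiMultigraph} {l v w : ℕ} (hv : v ∈ G.verts) (h : w ∈ G.ball l v) :
    v ∈ G.ball l w := by
  obtain ⟨_, p, hp⟩ := mem_ball.1 h
  exact mem_ball.2 ⟨hv, p.reverse, by simpa using hp⟩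

theorem mem_edgeBall {G : DiMultigraph} {l w : ℕ} {e : Edge} :
    w ∈ G.edgeBall l e ↔ w ∈ G.ball l e.src ∨ w ∈ G.ball l e.dst := by
  simp [edgeBall]

theorem mem_edgeBall_zero {G : DiMultigraph} {w : ℕ} {e : Edge} :
    w ∈ G.edgeBall 0 e ↔ w ∈ G.verts ∧ (w = e.src ∨ w = e.dst) := by
  rw [mem_edgeBall, mem_ball_zero, mem_ball_zero, and_or_left]

theorem mem_edgeBall_succ {G : DiMultigraph} {l w : ℕ} {e : Edge} :
    w ∈ G.edgeBall (l + 1) e ↔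
      w ∈ G.edgeBall l e ∨ ∃ u ∈ G.edgeBall l e, G.underlying.Adj w u := by
  simp only [mem_edgeBall, mem_ball_succ, or_and_right, exists_or]
  exact or_or_or_comm

theorem edgeBall_subset_verts {G : DiMultigraph} {l : ℕ} {e : Edge} :
    G.edgeBall l e ⊆ G.verts := by
  intro w hw
  rcases mem_edgeBall.1 hw with h | h <;> exact (mem_ball.1 h).1

theorem edgeBall_mono_radius {G : DiMultigraph} {l l' : ℕ} (h : l ≤ l') {e : Edge} :
    G.edgeBall l e ⊆ G.edgeBall l' e := by
  induction h with
  | refl => exact subset_rfl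
  | step _ ih => exact ih.trans fun w hw => mem_edgeBall_succ.2 (Or.inl hw)

theorem edgeBall_mono {H G : DiMultigraph} (hv : H.verts ⊆ G.verts)
    (he : ∀ f ∈ H.edges, f ∈ G.edges) (l : ℕ) (e : Edge) : H.edgeBall l e ⊆ G.edgeBall l e := by
  induction l with
  | zero =>
    intro w hw
    rw [mem_edgeBall_zero] at hw ⊢
    exact ⟨hv hw.1, hw.2⟩
  | succ l ih =>
    intro w hw
    rw [mem_edgeBall_succ] at hw ⊢
    refine hw.imp (fun h => ih h) ?_
    rintro ⟨u, hu, f, hf, hfu⟩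
    exact ⟨u, ih hu, f, he f hf, hfu⟩

theorem src_mem_edgeBall {G : DiMultigraph} {e : Edge} (h : e.src ∈ G.verts) (l : ℕ) :
    e.src ∈ G.edgeBall l e :=
  edgeBall_mono_radius (Nat.zero_le l) (mem_edgeBall_zero.2 ⟨h, Or.inl rfl⟩)

theorem dst_mem_edgeBall {G : DiMultigraph} {e : Edge} (h : e.dst ∈ G.verts) (l : ℕ) :
    e.dst ∈ G.edgeBall l e :=
  edgeBall_mono_radius (Nat.zero_le l) (mem_edgeBall_zero.2 ⟨h, Or.inr rfl⟩)

theorem endpoints_mem_edgeBall_succ {G : DiMultigraph} {l : ℕ} {e f : Edge} (hf : f ∈ G.edges)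
    (h : f.src ∈ G.edgeBall l e ∨ f.dst ∈ G.edgeBall l e) :
    f.src ∈ G.edgeBall (l + 1) e ∧ f.dst ∈ G.edgeBall (l + 1) e := by
  rcases h with h | h
  · exact ⟨mem_edgeBall_succ.2 (Or.inl h),
      mem_edgeBall_succ.2 (Or.inr ⟨_, h, f, hf, Or.inr ⟨rfl, rfl⟩⟩)⟩
  · exact ⟨mem_edgeBall_succ.2 (Or.inr ⟨_, h, f, hf, Or.inl ⟨rfl, rfl⟩⟩),
      mem_edgeBall_succ.2 (Or.inl h)⟩

/-- Copies of the edge `e` do not affect the balls around `e`. -/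
theorem edgeBall_congr_of_parallel {H G : DiMultigraph} {e : Edge} (hv : H.verts = G.verts)
    (he : ∀ f, f ≠ e → (f ∈ H.edges ↔ f ∈ G.edges)) (hs : e.src ∈ G.verts)
    (hd : e.dst ∈ G.verts) (l : ℕ) : H.edgeBall l e = G.edgeBall l e := by
  have key : ∀ {H G : DiMultigraph}, H.verts = G.verts →
      (∀ f, f ≠ e → (f ∈ H.edges ↔ f ∈ G.edges)) → e.src ∈ G.verts → e.dst ∈ G.verts →
      H.edgeBall l e ⊆ G.edgeBall l e := by
    intro H G hv he hs hd
    induction l with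
    | zero =>
      intro w hw
      rw [mem_edgeBall_zero] at hw ⊢
      rwa [← hv]
    | succ l ih =>
      intro w hw
      rw [mem_edgeBall_succ] at hw
      rcases hw with h | ⟨u, hu, f, hf, hfu⟩
      · exact mem_edgeBall_succ.2 (Or.inl (ih h))
      · by_cases hfe : f = e
        · subst hfe
          rcases hfu with ⟨rfl, _⟩ | ⟨_, rfl⟩
          · exact src_mem_edgeBall hs _
          · exact dst_mem_edgeBall hd _
        · exact mem_edgeBall_succ.2 (Or.inr ⟨u, ih hu, f, (he f hfe).1 hf, hfu⟩)
  exact Finset.Subset.antisymm (key hv he hs hd)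
    (key hv.symm (fun f hf => (he f hf).symm) (hv ▸ hs) (hv ▸ hd))

/-! ### Sizes of balls -/

/-- Charge each edge of `F` to an endpoint in `U`; with multiplicity, no vertex of `U` is charged
more than its degree. -/
theorem countP_touch_le {F : Multiset Edge} {G : DiMultigraph} {D : ℕ} (hG : G.IsBounded D)
    (hF : F ≤ G.edges) (U : Finset ℕ) (hU : U ⊆ G.verts)
    (h : ∀ f ∈ F, f.src ∈ U ∨ f.dst ∈ U) : Multiset.card F ≤ U.card * D := by
  classical
  have h1 : Multiset.card F ≤ ∑ v ∈ U, (F.countP (fun e => e.dst = v) +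
      F.countP (fun e => e.src = v)) := by
    clear hF
    induction F using Multiset.induction_on with
    | empty => simp
    | cons f F ih =>
      have ih' := ih fun g hg => h g (Multiset.mem_cons_of_mem hg)
      simp only [Multiset.countP_cons, Multiset.card_cons]
      have h2 : 1 ≤ ∑ v ∈ U, ((if f.dst = v then 1 else 0) + (if f.src = v then 1 else 0)) := by
        rcases h f (Multiset.mem_cons_self f F) with hf | hf
        · refine le_trans ?_ (Finset.single_le_sum (fun _ _ => Nat.zero_le _) hf)
          simp
        · refine le_trans ?_ (Finset.single_le_sum (fun _ _ => Nat.zero_le _) hf)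
          simp
      calc Multiset.card F + 1 ≤ _ := Nat.add_le_add ih' h2
        _ = _ := by
          rw [← Finset.sum_add_distrib]
          refine Finset.sum_congr rfl fun v _ => ?_
          ring
  refine h1.trans ?_
  rw [← smul_eq_mul, ← Finset.sum_const]
  refine Finset.sum_le_sum fun v hv => le_trans ?_ (hG v (hU hv))
  exact Nat.add_le_add (Multiset.countP_le_of_le _ hF) (Multiset.countP_le_of_le _ hF)

theorem card_neighbors_le {G : DiMultigraph} {D : ℕ} (hG : G.IsBounded D) {v : ℕ}
    (hv : v ∈ G.verts) (U : Finset ℕ) (hU : ∀ w ∈ U, G.underlying.Adj w v) : U.card ≤ D := by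
  classical
  have h1 : U ⊆ ((G.edges.filter fun e => e.dst = v).map Edge.src +
      (G.edges.filter fun e => e.src = v).map Edge.dst).toFinset := by
    intro w hw
    obtain ⟨e, he, ⟨rfl, h⟩ | ⟨h, rfl⟩⟩ := hU w hw
    · simp only [Multiset.toFinset_add, Finset.mem_union, Multiset.mem_toFinset, Multiset.mem_map,
        Multiset.mem_filter]
      exact Or.inl ⟨e, ⟨he, h⟩, rfl⟩
    · simp only [Multiset.toFinset_add, Finset.mem_union, Multiset.mem_toFinset, Multiset.mem_map,
        Multiset.mem_filter]
      exact Or.inr ⟨e, ⟨he, h⟩, rfl⟩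
  refine (Finset.card_le_card h1).trans ((Multiset.toFinset_card_le _).trans ?_)
  refine le_trans (le_of_eq ?_) (hG v hv)
  rw [Multiset.card_add, Multiset.card_map, Multiset.card_map, degree, Multiset.countP_eq_card_filter,
    Multiset.countP_eq_card_filter]

theorem card_ball_le {G : DiMultigraph} {D : ℕ} (hG : G.IsBounded D) (l v : ℕ) :
    (G.ball l v).card ≤ (D + 1) ^ l := by
  classical
  induction l with
  | zero =>
    rw [pow_zero, Finset.card_le_one]
    intro a ha b hb
    rw [(mem_ball_zero.1 ha).2, (mem_ball_zero.1 hb).2]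
  | succ l ih =>
    have h1 : G.ball (l + 1) v ⊆ (G.ball l v).biUnion
        (fun u => insert u (G.verts.filter (fun w => G.underlying.Adj w u))) := by
      intro w hw
      rw [Finset.mem_biUnion]
      rcases mem_ball_succ.1 hw with h | ⟨u, hu, ha⟩
      · exact ⟨w, h, Finset.mem_insert_self _ _⟩
      · exact ⟨u, hu, Finset.mem_insert_of_mem (Finset.mem_filter.2 ⟨mem_verts_of_adj ha, ha⟩)⟩
    refine (Finset.card_le_card h1).trans ((Finset.card_biUnion_le_card_mul _ _ (D + 1) ?_).trans ?_)
    · intro u hu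
      refine (Finset.card_insert_le _ _).trans (Nat.succ_le_succ ?_)
      exact card_neighbors_le hG (mem_ball.1 hu).1 _ fun w hw => (Finset.mem_filter.1 hw).2
    · rw [pow_succ]
      exact Nat.mul_le_mul_right _ ih

theorem card_edgeBall_le {G : DiMultigraph} {D : ℕ} (hG : G.IsBounded D) (l : ℕ) (e : Edge) :
    (G.edgeBall l e).card ≤ 2 * (D + 1) ^ l := by
  refine (Finset.card_union_le _ _).trans ?_
  have := card_ball_le hG l e.src
  have := card_ball_le hG l e.dst
  omega

/-! ### Relabelling -/

/-- The image of a graph under a relabelling of the vertices. -/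
def relabel (φ : Equiv.Perm ℕ) (G : DiMultigraph) : DiMultigraph where
  verts := G.verts.map φ.toEmbedding
  edges := G.edges.map (Edge.map φ)
  src_mem e he := by
    obtain ⟨f, hf, rfl⟩ := Multiset.mem_map.1 he
    exact Finset.mem_map_of_mem _ (G.src_mem f hf)
  dst_mem e he := by
    obtain ⟨f, hf, rfl⟩ := Multiset.mem_map.1 he
    exact Finset.mem_map_of_mem _ (G.dst_mem f hf)

@[simp]
theorem mem_verts_relabel {φ : Equiv.Perm ℕ} {G : DiMultigraph} {v : ℕ} :
    φ v ∈ (G.relabel φ).verts ↔ v ∈ G.verts := by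
  simp [relabel]

end DiMultigraph

theorem Edge.map_injective (φ : Equiv.Perm ℕ) : Function.Injective (Edge.map φ) := by
  intro e f h
  have h1 := congrArg Edge.src h
  have h2 := congrArg Edge.dst h
  exact Edge.ext (φ.injective h1) (φ.injective h2)

theorem Edge.map_symm_map (φ : Equiv.Perm ℕ) (e : Edge) : Edge.map φ.symm (Edge.map φ e) = e := by
  ext <;> simp [Edge.map]

theorem Edge.map_map_symm (φ : Equiv.Perm ℕ) (e : Edge) : Edge.map φ (Edge.map φ.symm e) = e := by
  ext <;> simp [Edge.map]

namespace DiMultigraph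

theorem adj_relabel {φ : Equiv.Perm ℕ} {G : DiMultigraph} {u v : ℕ} :
    (G.relabel φ).underlying.Adj (φ u) (φ v) ↔ G.underlying.Adj u v := by
  simp only [adj_iff, relabel, Multiset.mem_map]
  constructor
  · rintro ⟨_, ⟨e, he, rfl⟩, h⟩
    refine ⟨e, he, ?_⟩
    simpa [Edge.map] using h
  · rintro ⟨e, he, h⟩
    refine ⟨_, ⟨e, he, rfl⟩, ?_⟩
    simpa [Edge.map] using h

theorem mem_edgeBall_relabel {φ : Equiv.Perm ℕ} {G : DiMultigraph} {l v : ℕ} {e : Edge} :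
    φ v ∈ (G.relabel φ).edgeBall l (e.map φ) ↔ v ∈ G.edgeBall l e := by
  induction l generalizing v with
  | zero => simp [mem_edgeBall_zero, Edge.map]
  | succ l ih =>
    rw [mem_edgeBall_succ, mem_edgeBall_succ, ih, φ.surjective.exists]
    simp only [ih, adj_relabel]

theorem addEdge_relabel {φ : Equiv.Perm ℕ} {G : DiMultigraph} {f : Edge} :
    (G.relabel φ).addEdge (f.map φ) = (G.addEdge f).relabel φ := by
  ext1
  · simp [addEdge, relabel, Edge.map]
  · simp [addEdge, relabel]

theorem endpoints_relabel {φ : Equiv.Perm ℕ} {e : Edge} :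
    endpoints (e.map φ) = (endpoints e).relabel φ := by
  ext1
  · simp [endpoints, relabel, Edge.map]
  · simp [endpoints, relabel]

end DiMultigraph

theorem typeOf_relabel {k : ℕ} (φ : Equiv.Perm ℕ) (G : DiMultigraph) (χ χ' : ℕ → Fin k) (e : Edge)
    (h : ∀ v ∈ G.verts, χ v = χ' (φ v)) : typeOf (G.relabel φ) χ' (e.map φ) = typeOf G χ e :=
  (Quotient.sound ⟨φ, rfl, rfl, h, rfl⟩ : typeOf G χ e = _).symm

/-- Equal coincidence patterns make `f i ↦ g i` a well-defined injection on a finite set of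
naturals, and such an injection extends to a permutation. This produces the relabellings used for
small representatives of types and for comparing memories. -/
theorem exists_perm_of_eq_iff {ι : Type} [Finite ι] (f g : ι → ℕ)
    (h : ∀ i j, f i = f j ↔ g i = g j) : ∃ φ : Equiv.Perm ℕ, ∀ i, φ (f i) = g i := by
  classical
  have hc : ∀ x : Set.range f, ∃ i, f i = x := fun x => x.2
  choose c hc using hc
  let F : Set.range f ↪ ℕ := ⟨fun x => g (c x), fun x y hxy => by
    have := (h _ _).2 hxy
    rw [hc, hc] at this
    exact Subtype.ext this⟩
  obtain ⟨φ, hφ⟩ := Cardinal.extend_function_of_lt F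
    (lt_of_lt_of_le (Cardinal.lt_aleph0_of_finite _) (by simp)) ⟨Equiv.refl ℕ⟩
  refine ⟨φ, fun i => ?_⟩
  rw [hφ ⟨f i, i, rfl⟩]
  exact (h _ _).1 (hc _)

end DicutStream

namespace DicutStream

open DiMultigraph

/-! ### Visible neighborhoods -/

/-- The edge `f` is recorded next in the exploration `H` of radius `l` from `e`. -/
def Touches (l : ℕ) (e : Edge) (H : DiMultigraph) (f : Edge) : Prop :=
  f.src ∈ H.edgeBall (l - 1) e ∨ f.dst ∈ H.edgeBall (l - 1) e

theorem visNbhd_append (l : ℕ) (e : Edge) (σ : List Edge) (f : Edge) :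
    visNbhd l e (σ ++ [f]) = visStep l e (visNbhd l e σ) f := by
  simp [visNbhd]

theorem visNbhd_append_of_touches {l : ℕ} {e : Edge} {σ : List Edge} {f : Edge}
    (h : Touches l e (visNbhd l e σ) f) :
    visNbhd l e (σ ++ [f]) = (visNbhd l e σ).addEdge f := by
  rw [visNbhd_append]
  exact if_pos h

theorem visNbhd_append_of_not_touches {l : ℕ} {e : Edge} {σ : List Edge} {f : Edge}
    (h : ¬ Touches l e (visNbhd l e σ) f) :
    visNbhd l e (σ ++ [f]) = visNbhd l e σ := by
  rw [visNbhd_append]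
  exact if_neg h

theorem touches_relabel {φ : Equiv.Perm ℕ} {l : ℕ} {e : Edge} {H : DiMultigraph} {f : Edge} :
    Touches l (e.map φ) (H.relabel φ) (f.map φ) ↔ Touches l e H f :=
  or_congr mem_edgeBall_relabel mem_edgeBall_relabel

theorem visNbhd_relabel (φ : Equiv.Perm ℕ) (l : ℕ) (e : Edge) (σ : List Edge) :
    visNbhd l (e.map φ) (σ.map (Edge.map φ)) = (visNbhd l e σ).relabel φ := by
  induction σ using List.reverseRecOn with
  | nil => exact endpoints_relabel
  | append_singleton σ f ih =>
    rw [List.map_append, List.map_singleton]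
    by_cases h : Touches l e (visNbhd l e σ) f
    · rw [visNbhd_append_of_touches h, visNbhd_append_of_touches (by rwa [ih, touches_relabel]), ih,
        addEdge_relabel]
    · rw [visNbhd_append_of_not_touches h,
        visNbhd_append_of_not_touches (by rwa [ih, touches_relabel]), ih]

theorem root_mem_verts_visNbhd (l : ℕ) (e : Edge) (σ : List Edge) :
    e.src ∈ (visNbhd l e σ).verts ∧ e.dst ∈ (visNbhd l e σ).verts := by
  induction σ using List.reverseRecOn with
  | nil => simp [visNbhd, endpoints]
  | append_singleton σ f ih =>
    by_cases h : Touches l e (visNbhd l e σ) f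
    · rw [visNbhd_append_of_touches h]
      simp [addEdge, ih]
    · rwa [visNbhd_append_of_not_touches h]

theorem touches_root (l : ℕ) (e : Edge) (σ : List Edge) : Touches l e (visNbhd l e σ) e :=
  Or.inl (src_mem_edgeBall (root_mem_verts_visNbhd l e σ).1 _)

theorem visNbhd_edges_le (l : ℕ) (e : Edge) (σ : List Edge) :
    (visNbhd l e σ).edges ≤ (σ : Multiset Edge) := by
  induction σ using List.reverseRecOn with
  | nil => simp [visNbhd, endpoints]
  | append_singleton σ f ih =>
    have hσ : ((σ ++ [f] : List Edge) : Multiset Edge) = f ::ₘ (σ : Multiset Edge) := by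
      rw [← Multiset.coe_add, add_comm]; rfl
    by_cases h : Touches l e (visNbhd l e σ) f
    · rw [visNbhd_append_of_touches h, hσ]
      exact Multiset.cons_le_cons f ih
    · rw [visNbhd_append_of_not_touches h, hσ]
      exact ih.trans (Multiset.le_cons_self _ _)

theorem mem_of_mem_visNbhd_edges {l : ℕ} {e : Edge} {σ : List Edge} {f : Edge}
    (h : f ∈ (visNbhd l e σ).edges) : f ∈ σ :=
  Multiset.mem_coe.1 (Multiset.mem_of_le (visNbhd_edges_le l e σ) h)

theorem mem_visNbhd_verts {l : ℕ} {e : Edge} {σ : List Edge} {v : ℕ}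
    (h : v ∈ (visNbhd l e σ).verts) :
    (v = e.src ∨ v = e.dst) ∨ ∃ f ∈ σ, v = f.src ∨ v = f.dst := by
  induction σ using List.reverseRecOn with
  | nil => simpa [visNbhd, endpoints] using h
  | append_singleton σ f ih =>
    have ih' : v ∈ (visNbhd l e σ).verts → _ := fun hv => (ih hv).imp id
      fun ⟨g, hg, hvg⟩ => (⟨g, List.mem_append_left [f] hg, hvg⟩ :
        ∃ g ∈ σ ++ [f], v = g.src ∨ v = g.dst)
    by_cases ht : Touches l e (visNbhd l e σ) f
    · rw [visNbhd_append_of_touches ht] at h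
      simp only [addEdge, Finset.mem_insert] at h
      rcases h with h | h | h
      · exact Or.inr ⟨f, by simp, Or.inl h⟩
      · exact Or.inr ⟨f, by simp, Or.inr h⟩
      · exact ih' h
    · rw [visNbhd_append_of_not_touches ht] at h
      exact ih' h

theorem root_mem_visNbhd_edges {l : ℕ} {e : Edge} {σ : List Edge} (he : e ∈ σ) :
    e ∈ (visNbhd l e σ).edges := by
  induction σ using List.reverseRecOn with
  | nil => simp at he
  | append_singleton σ f ih =>
    by_cases hef : e = f
    · subst hef
      rw [visNbhd_append_of_touches (touches_root l e σ)]
      exact Multiset.mem_cons_self _ _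
    · have he' : e ∈ σ := by simpa [hef] using he
      by_cases ht : Touches l e (visNbhd l e σ) f
      · rw [visNbhd_append_of_touches ht]
        exact Multiset.mem_cons_of_mem (ih he')
      · rw [visNbhd_append_of_not_touches ht]
        exact ih he'

theorem visNbhd_verts_subset {G : DiMultigraph} {l : ℕ} {e : Edge} {σ : List Edge}
    (hs : e.src ∈ G.verts) (hd : e.dst ∈ G.verts) (hσ : ∀ f ∈ σ, f ∈ G.edges) :
    (visNbhd l e σ).verts ⊆ G.verts := by
  intro v hv
  rcases mem_visNbhd_verts hv with (rfl | rfl) | ⟨f, hf, rfl | rfl⟩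
  · exact hs
  · exact hd
  · exact G.src_mem f (hσ f hf)
  · exact G.dst_mem f (hσ f hf)

/-- A recorded edge has an end within `l - 1` of the root, so once it is added both its ends are
within `l`. Vertices added earlier stay in the ball because balls only grow. -/
theorem visNbhd_verts_subset_edgeBall {l : ℕ} (hl : 1 ≤ l) {e : Edge} {σ : List Edge} :
    (visNbhd l e σ).verts ⊆ (visNbhd l e σ).edgeBall l e := by
  induction σ using List.reverseRecOn with
  | nil =>
    intro v hv
    refine edgeBall_mono_radius (Nat.zero_le l) (mem_edgeBall_zero.2 ⟨hv, ?_⟩)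
    simpa [visNbhd, endpoints] using hv
  | append_singleton σ f ih =>
    by_cases ht : Touches l e (visNbhd l e σ) f
    · rw [visNbhd_append_of_touches ht]
      have hmono : ∀ r, (visNbhd l e σ).edgeBall r e ⊆
          ((visNbhd l e σ).addEdge f).edgeBall r e := fun r =>
        edgeBall_mono (by intro v hv; simp [addEdge, hv])
          (fun g hg => Multiset.mem_cons_of_mem hg) r e
      have hf := endpoints_mem_edgeBall_succ (G := (visNbhd l e σ).addEdge f) (l := l - 1) (e := e)
        (Multiset.mem_cons_self f _) (ht.imp (fun h => hmono _ h) (fun h => hmono _ h))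
      rw [Nat.sub_add_cancel hl] at hf
      intro v hv
      simp only [addEdge, Finset.mem_insert] at hv
      rcases hv with rfl | rfl | hv
      · exact hf.1
      · exact hf.2
      · exact hmono _ (ih hv)
    · rwa [visNbhd_append_of_not_touches ht]

/-- Edges that leave the ball around the root are never recorded. -/
theorem touches_subset_edgeBall {G : DiMultigraph} {l : ℕ} (hl : 1 ≤ l) {e f : Edge}
    {σ : List Edge} (hs : e.src ∈ G.verts) (hd : e.dst ∈ G.verts) (hσ : ∀ g ∈ σ, g ∈ G.edges)
    (hf : f ∈ G.edges) (ht : Touches l e (visNbhd l e σ) f) :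
    f.src ∈ G.edgeBall l e ∧ f.dst ∈ G.edgeBall l e := by
  have hmono := edgeBall_mono (visNbhd_verts_subset (l := l) hs hd hσ)
    (fun g hg => hσ g (mem_of_mem_visNbhd_edges hg)) (l - 1) e
  have := endpoints_mem_edgeBall_succ hf (ht.imp (fun h => hmono h) (fun h => hmono h))
  rwa [Nat.sub_add_cancel hl] at this

theorem visNbhd_edges_subset_edgeBall {G : DiMultigraph} {l : ℕ} (hl : 1 ≤ l) {e f : Edge}
    {σ : List Edge} (hs : e.src ∈ G.verts) (hd : e.dst ∈ G.verts) (hσ : ∀ g ∈ σ, g ∈ G.edges)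
    (hf : f ∈ (visNbhd l e σ).edges) : f.src ∈ G.edgeBall l e ∧ f.dst ∈ G.edgeBall l e := by
  have hsub := visNbhd_verts_subset_edgeBall hl (e := e) (σ := σ)
  have hmono := edgeBall_mono (visNbhd_verts_subset (l := l) hs hd hσ)
    (fun g hg => hσ g (mem_of_mem_visNbhd_edges hg)) l e
  exact ⟨hmono (hsub ((visNbhd l e σ).src_mem f hf)), hmono (hsub ((visNbhd l e σ).dst_mem f hf))⟩

theorem card_visNbhd_edges_le {G : DiMultigraph} {D : ℕ} (hG : G.IsBounded D) {l : ℕ} (hl : 1 ≤ l)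
    {e : Edge} {σ : List Edge} (he : e ∈ G.edges) (hσ : (σ : Multiset Edge) ≤ G.edges) :
    Multiset.card (visNbhd l e σ).edges ≤ 2 * (D + 1) ^ l * D := by
  have hσ' : ∀ g ∈ σ, g ∈ G.edges := fun g hg => Multiset.mem_of_le hσ (Multiset.mem_coe.2 hg)
  refine (countP_touch_le hG ((visNbhd_edges_le l e σ).trans hσ) (G.edgeBall l e)
    edgeBall_subset_verts fun f hf => Or.inl ?_).trans
    (Nat.mul_le_mul_right _ (card_edgeBall_le hG l e))
  exact (visNbhd_edges_subset_edgeBall hl (G.src_mem e he) (G.dst_mem e he) hσ' hf).1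

/-- The edges on whose order the radius-`l` visible neighborhood of `e` in `G` depends. -/
def Relevant (G : DiMultigraph) (l : ℕ) (e f : Edge) : Prop :=
  f ≠ e ∧ f.src ∈ G.edgeBall l e ∧ f.dst ∈ G.edgeBall l e

-- Only edges inside the ball are ever recorded, so the exploration in `G` agrees with the one in
-- the graph induced on the ball, from which the neighborhood type is formed.
open Classical in
theorem visNbhd_filter_edgeBall {G : DiMultigraph} {l : ℕ} (hl : 1 ≤ l) {e : Edge}
    {σ : List Edge} (he : e ∈ G.edges) (hσ : ∀ g ∈ σ, g ∈ G.edges) :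
    visNbhd l e (σ.filter fun f => f.src ∈ G.edgeBall l e ∧ f.dst ∈ G.edgeBall l e) =
      visNbhd l e σ := by
  induction σ using List.reverseRecOn with
  | nil => rfl
  | append_singleton σ f ih =>
    have hσ' : ∀ g ∈ σ, g ∈ G.edges := fun g hg => hσ g (List.mem_append_left _ hg)
    have ih := ih hσ'
    rw [List.filter_append]
    by_cases hf : f.src ∈ G.edgeBall l e ∧ f.dst ∈ G.edgeBall l e
    · rw [List.filter_singleton, decide_eq_true hf, cond_true, visNbhd_append, ih, visNbhd_append]
    · rw [List.filter_singleton, decide_eq_false hf, cond_false, List.append_nil, ih,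
        visNbhd_append_of_not_touches]
      exact fun ht => hf (touches_subset_edgeBall hl (G.src_mem e he) (G.dst_mem e he) hσ'
        (hσ f (by simp)) ht)

-- Copies of `e` are always recorded, but they add no vertex and leave all balls around `e`
-- unchanged. So the explorations with and without them make the same decisions about every other
-- edge, and the results differ exactly by these copies.
open Classical in
theorem visNbhd_filter_relevant {G : DiMultigraph} {l : ℕ} (hl : 1 ≤ l) {e : Edge}
    {σ : List Edge} (he : e ∈ G.edges) (hσ : ∀ g ∈ σ, g ∈ G.edges) :
    (visNbhd l e σ).verts = (visNbhd l e (σ.filter fun f => Relevant G l e f)).verts ∧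
    (visNbhd l e σ).edges = (visNbhd l e (σ.filter fun f => Relevant G l e f)).edges +
      Multiset.replicate (σ.count e) e := by
  induction σ using List.reverseRecOn with
  | nil => simp
  | append_singleton σ f ih =>
    have hσ' : ∀ g ∈ σ, g ∈ G.edges := fun g hg => hσ g (List.mem_append_left _ hg)
    obtain ⟨ihv, ihe⟩ := ih hσ'
    have hroot := root_mem_verts_visNbhd l e (σ.filter fun f => Relevant G l e f)
    rw [List.filter_append]
    by_cases hfe : f = e
    · subst hfe
      have hnr : ¬ Relevant G l f f := fun h => h.1 rfl
      rw [List.filter_singleton, decide_eq_false hnr, cond_false, List.append_nil,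
        visNbhd_append_of_touches (touches_root l f σ), List.count_append]
      constructor
      · simp only [addEdge, ihv, Finset.insert_eq_of_mem hroot.2, Finset.insert_eq_of_mem hroot.1]
      · rw [show List.count f [f] = 1 by simp, Multiset.replicate_succ, Multiset.add_cons, ← ihe]
        rfl
    · have hball : ∀ r, (visNbhd l e σ).edgeBall r e =
          (visNbhd l e (σ.filter fun f => Relevant G l e f)).edgeBall r e := fun r => by
        refine edgeBall_congr_of_parallel ihv (fun g hg => ?_) hroot.1 hroot.2 r
        rw [ihe, Multiset.mem_add, Multiset.mem_replicate]
        simp [hg]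
      have hiff : Touches l e (visNbhd l e σ) f ↔
          Touches l e (visNbhd l e (σ.filter fun f => Relevant G l e f)) f := by
        rw [Touches, Touches, hball]
      have hcount : (σ ++ [f]).count e = σ.count e := by
        rw [List.count_append, List.count_singleton]
        simp [hfe]
      rw [hcount]
      by_cases ht : Touches l e (visNbhd l e σ) f
      · have hr : Relevant G l e f := ⟨hfe, touches_subset_edgeBall hl (G.src_mem e he)
          (G.dst_mem e he) hσ' (hσ f (by simp)) ht⟩
        rw [List.filter_singleton, decide_eq_true hr, cond_true, visNbhd_append_of_touches ht,
          visNbhd_append_of_touches (hiff.1 ht)]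
        simp only [addEdge, ihv, ihe, Multiset.cons_add, and_self]
      · rw [visNbhd_append_of_not_touches ht]
        by_cases hr : Relevant G l e f
        · rw [List.filter_singleton, decide_eq_true hr, cond_true,
            visNbhd_append_of_not_touches (fun h => ht (hiff.2 h))]
          exact ⟨ihv, ihe⟩
        · rw [List.filter_singleton, decide_eq_false hr, cond_false, List.append_nil]
          exact ⟨ihv, ihe⟩

open Classical in
/-- The visible neighborhood of `e` only depends on the order of the relevant edges. -/
theorem visNbhd_congr {G : DiMultigraph} {l : ℕ} (hl : 1 ≤ l) {e : Edge}
    {σ σ' : List Edge} (he : e ∈ G.edges) (hσ : ∀ g ∈ σ, g ∈ G.edges)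
    (hσ' : ∀ g ∈ σ', g ∈ G.edges) (hc : σ.count e = σ'.count e)
    (hf : (σ.filter fun f => Relevant G l e f) = σ'.filter fun f => Relevant G l e f) :
    visNbhd l e σ = visNbhd l e σ' := by
  obtain ⟨h1, h2⟩ := visNbhd_filter_relevant hl he hσ
  obtain ⟨h3, h4⟩ := visNbhd_filter_relevant hl he hσ'
  ext1
  · rw [h1, h3, hf]
  · rw [h2, h4, hf, hc]

theorem typeOf_visNbhd_mem_boundedTypes {k : ℕ} {G : DiMultigraph} {D : ℕ} (hG : G.IsBounded D)
    {χ : ℕ → Fin k} (hχ : G.IsProperColoring χ) {l : ℕ} (hl : 1 ≤ l) {e : Edge} {σ : List Edge}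
    (he : e ∈ σ) (hσ : (σ : Multiset Edge) ≤ G.edges) :
    visType χ σ l e ∈ boundedTypes k l D := by
  have hle := (visNbhd_edges_le l e σ).trans hσ
  have hσ' : ∀ g ∈ σ, g ∈ G.edges := fun g hg => Multiset.mem_of_le hσ (Multiset.mem_coe.2 hg)
  refine ⟨⟨visNbhd l e σ, χ, e⟩, rfl, ⟨root_mem_visNbhd_edges he, fun f hf =>
    hχ f (Multiset.mem_of_le hle hf)⟩, fun v hv => ?_, visNbhd_verts_subset_edgeBall hl⟩
  refine le_trans ?_ (hG v (visNbhd_verts_subset (G.src_mem e (hσ' e he)) (G.dst_mem e (hσ' e he))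
    hσ' hv))
  exact Nat.add_le_add (Multiset.countP_le_of_le _ hle) (Multiset.countP_le_of_le _ hle)

theorem visType_relabel {k : ℕ} (φ : Equiv.Perm ℕ) (χ χ' : ℕ → Fin k) (l : ℕ) (e : Edge)
    (σ : List Edge) (he : χ e.src = χ' (φ e.src) ∧ χ e.dst = χ' (φ e.dst))
    (h : ∀ f ∈ σ, χ f.src = χ' (φ f.src) ∧ χ f.dst = χ' (φ f.dst)) :
    visType χ' (σ.map (Edge.map φ)) l (e.map φ) = visType χ σ l e := by
  rw [visType, visNbhd_relabel]
  refine typeOf_relabel φ _ χ χ' e fun v hv => ?_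
  rcases mem_visNbhd_verts hv with (rfl | rfl) | ⟨f, hf, rfl | rfl⟩
  · exact he.1
  · exact he.2
  · exact (h f hf).1
  · exact (h f hf).2

end DicutStream

namespace DicutStream

/-! ### Counting orderings -/

theorem orderings_length {E : Multiset Edge} {σ : List Edge} (h : σ ∈ orderings E) :
    σ.length = Multiset.card E := by
  rw [← mem_orderings.1 h, Multiset.coe_card]

theorem mem_of_mem_orderings {E : Multiset Edge} {σ : List Edge} (h : σ ∈ orderings E) {f : Edge} :
    f ∈ σ ↔ f ∈ E := by
  rw [← mem_orderings.1 h, Multiset.mem_coe]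

theorem count_of_mem_orderings {E : Multiset Edge} {σ : List Edge} (h : σ ∈ orderings E)
    (f : Edge) : σ.count f = E.count f := by
  rw [← mem_orderings.1 h, Multiset.coe_count]

theorem filter_mem_orderings {E : Multiset Edge} {σ : List Edge} (h : σ ∈ orderings E)
    (p : Edge → Prop) [DecidablePred p] : σ.filter p ∈ orderings (E.filter p) := by
  rw [mem_orderings, ← mem_orderings.1 h, Multiset.filter_coe]

theorem orderings_map (φ : Equiv.Perm ℕ) (E : Multiset Edge) :
    orderings (E.map (Edge.map φ)) = (orderings E).image (List.map (Edge.map φ)) := by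
  ext σ
  simp only [mem_orderings, Finset.mem_image]
  constructor
  · intro h
    refine ⟨σ.map (Edge.map φ.symm), ?_, ?_⟩
    · rw [← Multiset.map_coe, h, Multiset.map_map]
      simp [Edge.map_symm_map]
    · rw [List.map_map]
      exact (List.map_congr_left fun e _ => Edge.map_map_symm φ e).trans (List.map_id σ)
  · rintro ⟨τ, h, rfl⟩
    rw [← Multiset.map_coe, h]

theorem sum_orderings_map (φ : Equiv.Perm ℕ) (E : Multiset Edge) (F : List Edge → ℝ) :
    ∑ σ ∈ orderings (E.map (Edge.map φ)), F σ =
      ∑ σ ∈ orderings E, F (σ.map (Edge.map φ)) := by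
  rw [orderings_map, Finset.sum_image]
  exact fun σ _ τ _ h => List.map_injective_iff.2 (Edge.map_injective φ) h

theorem card_orderings_map (φ : Equiv.Perm ℕ) (E : Multiset Edge) :
    (orderings (E.map (Edge.map φ))).card = (orderings E).card := by
  rw [orderings_map, Finset.card_image_of_injective]
  exact List.map_injective_iff.2 (Edge.map_injective φ)

/-! ### Reordering the edges with a given property -/

/-- Replace, one after the other, the entries of a list that satisfy `p` by the entries of `τ`. -/
def refill (p : Edge → Prop) [DecidablePred p] : List Edge → List Edge → List Edge
  | [], _ => []
  | a :: σ, [] => a :: refill p σ []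
  | a :: σ, t :: τ => if p a then t :: refill p σ τ else a :: refill p σ (t :: τ)

section refill

variable {p : Edge → Prop} [DecidablePred p]

theorem refill_cons_of_neg {a : Edge} (ha : ¬ p a) (σ τ : List Edge) :
    refill p (a :: σ) τ = a :: refill p σ τ := by
  cases τ <;> simp [refill, ha]

theorem refill_cons_of_pos {a : Edge} (ha : p a) (σ : List Edge) (t : Edge) (τ : List Edge) :
    refill p (a :: σ) (t :: τ) = t :: refill p σ τ := by
  simp [refill, ha]

/-- Refilling overwrites the `p`-entries in place. Hence the other entries keep both their order and
their positions, and refilling once more with the old `p`-entries undoes the change. The clause on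
positions is what makes events such as "`a` is at position `i`" invariant. -/
theorem refill_spec (σ τ : List Edge) (hlen : (σ.filter p).length = τ.length)
    (hτ : ∀ t ∈ τ, p t) :
    (refill p σ τ).filter p = τ ∧
    ((refill p σ τ).filter fun a => ¬ p a) = (σ.filter fun a => ¬ p a) ∧
    refill p (refill p σ τ) (σ.filter p) = σ ∧
    ∀ (a : Edge), ¬ p a → ∀ i : ℕ, (refill p σ τ)[i]? = some a ↔ σ[i]? = some a := by
  induction σ generalizing τ with
  | nil =>
    have : τ = [] := List.length_eq_zero_iff.1 (by simpa using hlen.symm)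
    subst this
    simp [refill]
  | cons b σ ih =>
    by_cases hb : p b
    · cases τ with
      | nil => simp [hb] at hlen
      | cons t τ =>
        have ht : p t := hτ t (by simp)
        obtain ⟨h1, h2, h3, h4⟩ := ih τ (by simpa [hb] using hlen)
          fun x hx => hτ x (List.mem_cons_of_mem _ hx)
        simp only [refill_cons_of_pos hb, List.filter_cons, ht, hb, decide_true, not_true,
          decide_false, if_true, Bool.false_eq_true, if_false, refill_cons_of_pos ht]
        refine ⟨by rw [h1], h2, by rw [h3], fun a ha i => ?_⟩
        cases i with
        | zero =>
          simp only [List.getElem?_cons_zero, Option.some.injEq]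
          exact ⟨fun h => absurd (h ▸ ht) ha, fun h => absurd (h ▸ hb) ha⟩
        | succ i => simpa using h4 a ha i
    · obtain ⟨h1, h2, h3, h4⟩ := ih τ (by simpa [hb] using hlen) hτ
      simp only [refill_cons_of_neg hb, List.filter_cons, hb, decide_true, not_false_eq_true,
        decide_false, if_true, Bool.false_eq_true, if_false]
      refine ⟨h1, by rw [h2], by rw [h3], fun a ha i => ?_⟩
      cases i with
      | zero => simp
      | succ i => simpa using h4 a ha i

variable {E : Multiset Edge} {σ τ : List Edge}

theorem refill_spec' (hσ : σ ∈ orderings E) (hτ : τ ∈ orderings (E.filter p)) :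
    (refill p σ τ).filter p = τ ∧
    ((refill p σ τ).filter fun a => ¬ p a) = (σ.filter fun a => ¬ p a) ∧
    refill p (refill p σ τ) (σ.filter p) = σ ∧
    ∀ (a : Edge), ¬ p a → ∀ i : ℕ, (refill p σ τ)[i]? = some a ↔ σ[i]? = some a := by
  refine refill_spec σ τ ?_ fun t ht => ?_
  · rw [orderings_length hτ, orderings_length (filter_mem_orderings hσ p)]
  · exact (Multiset.mem_filter.1 ((mem_of_mem_orderings hτ).1 ht)).2

theorem refill_mem_orderings (hσ : σ ∈ orderings E) (hτ : τ ∈ orderings (E.filter p)) :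
    refill p σ τ ∈ orderings E := by
  obtain ⟨h1, h2, -, -⟩ := refill_spec' hσ hτ
  rw [mem_orderings, ← Multiset.filter_add_not p (refill p σ τ : Multiset Edge),
    Multiset.filter_coe, Multiset.filter_coe, h1, h2, ← Multiset.filter_coe, mem_orderings.1 hτ,
    mem_orderings.1 hσ, Multiset.filter_add_not]

theorem refill_filter_of_disjoint (hσ : σ ∈ orderings E) (hτ : τ ∈ orderings (E.filter p))
    {q : Edge → Prop} [DecidablePred q] (hq : ∀ a, q a → ¬ p a) :
    (refill p σ τ).filter q = σ.filter q := by
  have key : ∀ ρ : List Edge, ρ.filter q = (ρ.filter fun a => ¬ p a).filter q := by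
    intro ρ
    rw [List.filter_filter]
    refine List.filter_congr fun a _ => ?_
    by_cases ha : q a
    · simp [ha, hq a ha]
    · simp [ha]
  rw [key, (refill_spec' hσ hτ).2.1, ← key]

/-- The order of the edges with property `p` is uniform, even given everything else. -/
theorem sum_mul_filter (E : Multiset Edge) (h Z : List Edge → ℝ)
    (hh : ∀ σ ∈ orderings E, ∀ τ ∈ orderings (E.filter p), h (refill p σ τ) = h σ) :
    ((orderings (E.filter p)).card : ℝ) * ∑ σ ∈ orderings E, h σ * Z (σ.filter p) =
      (∑ σ ∈ orderings E, h σ) * ∑ τ ∈ orderings (E.filter p), Z τ := by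
  rw [Finset.sum_mul_sum, ← Finset.sum_product', Finset.mul_sum]
  have h1 : ∑ σ ∈ orderings E, ((orderings (E.filter p)).card : ℝ) * (h σ * Z (σ.filter p)) =
      ∑ x ∈ orderings E ×ˢ orderings (E.filter p), h x.1 * Z (x.1.filter p) := by
    rw [Finset.sum_product]
    simp
  rw [h1]
  -- The map (σ, τ) ↦ (refilled σ, old `p`-sublist of σ) is an involution that exchanges the
  -- `p`-sublist of σ with τ and fixes `h`.
  refine Finset.sum_nbij' (fun x => (refill p x.1 x.2, x.1.filter p))
    (fun x => (refill p x.1 x.2, x.1.filter p)) ?_ ?_ ?_ ?_ ?_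
  · intro x hx
    obtain ⟨h1, h2⟩ := Finset.mem_product.1 hx
    exact Finset.mem_product.2 ⟨refill_mem_orderings h1 h2, filter_mem_orderings h1 p⟩
  · intro x hx
    obtain ⟨h1, h2⟩ := Finset.mem_product.1 hx
    exact Finset.mem_product.2 ⟨refill_mem_orderings h1 h2, filter_mem_orderings h1 p⟩
  · intro x hx
    obtain ⟨h1, h2⟩ := Finset.mem_product.1 hx
    obtain ⟨h3, -, h5, -⟩ := refill_spec' h1 h2
    exact Prod.ext h5 h3
  · intro x hx
    obtain ⟨h1, h2⟩ := Finset.mem_product.1 hx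
    obtain ⟨h3, -, h5, -⟩ := refill_spec' h1 h2
    exact Prod.ext h5 h3
  · intro x hx
    obtain ⟨h1, h2⟩ := Finset.mem_product.1 hx
    rw [hh _ h1 _ h2]

end refill

/-! ### The edges at given positions -/

/-- Erasing position `j` and inserting `b` there are mutually inverse. Orderings are distinct lists,
so parallel edges need no correction factor here. -/
theorem sum_getElem?_eraseIdx (E : Multiset Edge) {b : Edge} (hb : b ∈ E) {j : ℕ}
    (hj : j < Multiset.card E) (F : List Edge → ℕ) :
    ∑ σ ∈ orderings E with σ[j]? = some b, F (σ.eraseIdx j) =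
      ∑ ρ ∈ orderings (E.erase b), F ρ := by
  have hcard : Multiset.card (E.erase b) + 1 = Multiset.card E := Multiset.card_erase_add_one hb
  refine Finset.sum_nbij' (fun σ => σ.eraseIdx j) (fun ρ => ρ.insertIdx j b) ?_ ?_ ?_ ?_
    (fun _ _ => rfl)
  · intro σ hσ
    obtain ⟨h1, h2⟩ := Finset.mem_filter.1 hσ
    obtain ⟨h3, rfl⟩ := List.getElem?_eq_some_iff.1 h2
    have h4 := Multiset.coe_eq_coe.2 (List.getElem_cons_eraseIdx_perm h3)
    rw [mem_orderings.1 h1, ← Multiset.cons_coe] at h4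
    rw [mem_orderings, ← h4, Multiset.erase_cons_head]
  · intro ρ hρ
    have hlen : j ≤ ρ.length := by rw [orderings_length hρ]; omega
    rw [Finset.mem_filter, mem_orderings,
      Multiset.coe_eq_coe.2 (List.perm_insertIdx b ρ hlen), ← Multiset.cons_coe,
      mem_orderings.1 hρ, Multiset.cons_erase hb, List.getElem?_insertIdx_self, if_pos hlen]
    exact ⟨rfl, rfl⟩
  · intro σ hσ
    obtain ⟨h1, h2⟩ := Finset.mem_filter.1 hσ
    obtain ⟨h3, rfl⟩ := List.getElem?_eq_some_iff.1 h2
    exact List.insertIdx_eraseIdx_getElem h3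
  · intro ρ hρ
    exact List.eraseIdx_insertIdx_self b

theorem card_orderings_getElem? (E : Multiset Edge) {b : Edge} (hb : b ∈ E) {j : ℕ}
    (hj : j < Multiset.card E) :
    ((orderings E).filter fun σ => σ[j]? = some b).card = (orderings (E.erase b)).card := by
  simpa using sum_getElem?_eraseIdx E hb hj fun _ => 1

theorem count_eq_sum_getElem? (σ : List Edge) (b : Edge) :
    σ.count b = ∑ j ∈ Finset.range σ.length, if σ[j]? = some b then 1 else 0 := by
  induction σ with
  | nil => simp
  | cons a σ ih =>
    rw [List.count_cons, ih, List.length_cons, Finset.sum_range_succ']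
    simp [beq_iff_eq]

/-- Double counting of the pairs of an ordering and a position in it that holds `b`. -/
theorem card_mul_card_orderings_erase (E : Multiset Edge) {b : Edge} (hb : b ∈ E) :
    Multiset.card E * (orderings (E.erase b)).card = E.count b * (orderings E).card := by
  have h1 : ∑ σ ∈ orderings E, σ.count b = E.count b * (orderings E).card := by
    rw [Finset.sum_congr rfl fun σ hσ => count_of_mem_orderings hσ b, Finset.sum_const, smul_eq_mul,
      mul_comm]
  rw [← h1, Finset.sum_congr rfl fun σ hσ => (count_eq_sum_getElem? σ b).trans
    (by rw [orderings_length hσ]), Finset.sum_comm, ← smul_eq_mul, ← Finset.card_range (Multiset.card E),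
    ← Finset.sum_const]
  refine Finset.sum_congr (by simp) fun j hj => ?_
  rw [← card_orderings_getElem? E hb (by simpa using hj), Finset.card_filter]

/-- Every position of a random ordering holds a random edge. -/
theorem card_orderings_position (E : Multiset Edge) {b : Edge} (hb : b ∈ E) {j : ℕ}
    (hj : j < Multiset.card E) :
    Multiset.card E * ((orderings E).filter fun σ => σ[j]? = some b).card =
      E.count b * (orderings E).card := by
  rw [card_orderings_getElem? E hb hj, card_mul_card_orderings_erase E hb]

/-- Remove `b` and apply the one-position count to what is left. Only an inequality results, because
for `a = b` the removal lowers the multiplicity of `a`. -/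
theorem card_orderings_two_positions_le (E : Multiset Edge) {a b : Edge} (ha : a ∈ E) (hb : b ∈ E)
    {i j : ℕ} (hi : i < Multiset.card E) (hj : j < Multiset.card E) (hij : i ≠ j) :
    Multiset.card E * (Multiset.card E - 1) *
      ((orderings E).filter fun σ => σ[i]? = some a ∧ σ[j]? = some b).card ≤
      E.count a * E.count b * (orderings E).card := by
  -- With `i < j`, erasing position `j` does not shift position `i`.
  wlog hlt : i < j generalizing a b i j
  · have := this hb ha hj hi hij.symm (by omega)
    rw [mul_comm (E.count a)]
    refine le_trans (le_of_eq ?_) this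
    simp only [and_comm]
  have h1 : ((orderings E).filter fun σ => σ[i]? = some a ∧ σ[j]? = some b).card =
      ((orderings (E.erase b)).filter fun ρ => ρ[i]? = some a).card := by
    have := sum_getElem?_eraseIdx E hb hj fun ρ => if ρ[i]? = some a then 1 else 0
    rw [← Finset.card_filter, ← Finset.card_filter, Finset.filter_filter] at this
    rw [← this]
    congr 1
    refine Finset.filter_congr fun σ _ => ?_
    rw [List.getElem?_eraseIdx, if_pos hlt, and_comm]
  have hcard : Multiset.card (E.erase b) = Multiset.card E - 1 := by
    rw [Multiset.card_erase_of_mem hb]; rfl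
  rw [h1, mul_assoc, ← hcard]
  by_cases hab : a ∈ E.erase b
  · rw [card_orderings_position (E.erase b) hab (by omega), mul_left_comm,
      card_mul_card_orderings_erase E hb, mul_assoc]
    exact Nat.mul_le_mul_right _ (Multiset.count_le_of_le _ (Multiset.erase_le _ _))
  · rw [Finset.filter_false_of_mem]
    · simp
    · intro ρ hρ h
      exact hab ((mem_of_mem_orderings hρ).1 (List.mem_of_getElem? h))

end DicutStream

namespace DicutStream

open DiMultigraph

/-! ### Visible types in a random ordering -/

theorem card_orderings_pos (E : Multiset Edge) : (0 : ℝ) < (orderings E).card :=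
  Nat.cast_pos.2 (Finset.card_pos.2 (orderings_nonempty E))

section

open Classical

/-- The real-valued indicator of a proposition. -/
noncomputable def ind (P : Prop) : ℝ := if P then 1 else 0

theorem ind_nonneg (P : Prop) : 0 ≤ ind P := by unfold ind; split_ifs <;> norm_num

theorem ind_le_one (P : Prop) : ind P ≤ 1 := by unfold ind; split_ifs <;> norm_num

theorem sum_ind {α : Type*} (s : Finset α) (P : α → Prop) :
    ∑ a ∈ s, ind (P a) = ((s.filter P).card : ℝ) := by
  rw [Finset.card_filter]
  push_cast
  rfl

/-- The probability that the visible type of `e` is `T` in a random ordering of `G`. -/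
noncomputable def visProb {k : ℕ} (G : DiMultigraph) (χ : ℕ → Fin k) (l : ℕ) (T : GraphType k)
    (e : Edge) : ℝ :=
  (∑ σ ∈ orderings G.edges, ind (visType χ σ l e = T)) / (orderings G.edges).card

/-- The probability that the visible type of a random edge is `T` in a random ordering of `G`. -/
noncomputable def typeProb {k : ℕ} (G : DiMultigraph) (χ : ℕ → Fin k) (l : ℕ)
    (T : GraphType k) : ℝ :=
  (∑ e ∈ G.edges.toFinset, (G.edges.count e : ℝ) * visProb G χ l T e) / Multiset.card G.edges

variable {k : ℕ} {G : DiMultigraph} {χ : ℕ → Fin k} {l : ℕ} {T : GraphType k}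

theorem visProb_nonneg (e : Edge) : 0 ≤ visProb G χ l T e :=
  div_nonneg (Finset.sum_nonneg fun _ _ => ind_nonneg _) (card_orderings_pos _).le

theorem visProb_le_one (e : Edge) : visProb G χ l T e ≤ 1 := by
  refine div_le_one_of_le₀ ?_ (card_orderings_pos _).le
  refine (Finset.sum_le_card_nsmul _ _ 1 fun σ _ => ind_le_one _).trans (by simp)

theorem sum_count_toFinset (E : Multiset Edge) :
    ∑ e ∈ E.toFinset, (E.count e : ℝ) = Multiset.card E := by
  exact_mod_cast Multiset.toFinset_sum_count_eq E

theorem typeProb_nonneg : 0 ≤ typeProb G χ l T :=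
  div_nonneg (Finset.sum_nonneg fun e _ => mul_nonneg (Nat.cast_nonneg _) (visProb_nonneg e))
    (Nat.cast_nonneg _)

theorem typeProb_le_one : typeProb G χ l T ≤ 1 := by
  refine div_le_one_of_le₀ ?_ (Nat.cast_nonneg _)
  rw [← sum_count_toFinset]
  exact Finset.sum_le_sum fun e _ => mul_le_of_le_one_right (Nat.cast_nonneg _) (visProb_le_one e)

theorem sum_visType_indicator (e : Edge) :
    (∑ σ ∈ orderings G.edges, ind (visType χ σ l e = T)) =
      visProb G χ l T e * (orderings G.edges).card := by
  rw [visProb, div_mul_cancel₀ _ (card_orderings_pos _).ne']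

/-- The visible type of `a` is independent of everything unaffected by reordering the edges
relevant to `a`. -/
theorem sum_mul_visType_indicator (hl : 1 ≤ l) {a : Edge} (ha : a ∈ G.edges) (h : List Edge → ℝ)
    (hh : ∀ σ ∈ orderings G.edges, ∀ τ ∈ orderings (G.edges.filter (Relevant G l a)),
      h (refill (Relevant G l a) σ τ) = h σ) :
    (∑ σ ∈ orderings G.edges, h σ * ind (visType χ σ l a = T)) =
      visProb G χ l T a * ∑ σ ∈ orderings G.edges, h σ := by
  -- `Z` reads the visible type off the relevant sublist. The copies of `a` can be put at the end,
  -- as only their number matters.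
  set Z : List Edge → ℝ := fun τ =>
    ind (visType χ (τ ++ List.replicate (G.edges.count a) a) l a = T) with hZ
  have key : ∀ σ ∈ orderings G.edges, (ind (visType χ σ l a = T)) =
      Z (σ.filter (Relevant G l a)) := by
    intro σ hσ
    have hna : ¬ Relevant G l a a := fun h => h.1 rfl
    have : visNbhd l a σ = visNbhd l a (σ.filter (Relevant G l a) ++
        List.replicate (G.edges.count a) a) := by
      refine visNbhd_congr hl ha (fun g hg => (mem_of_mem_orderings hσ).1 hg) (fun g hg => ?_) ?_ ?_
      · rcases List.mem_append.1 hg with h | h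
        · exact (mem_of_mem_orderings hσ).1 (List.mem_filter.1 h).1
        · rwa [(List.mem_replicate.1 h).2]
      · rw [List.count_append, List.count_replicate_self, count_of_mem_orderings hσ,
          List.count_eq_zero_of_not_mem (by simp [hna]), zero_add]
      · rw [List.filter_append, List.filter_filter]
        simp [hna]
    simp only [hZ, visType, this]
  have h1 := sum_mul_filter G.edges h Z hh
  -- The case `h = 1` identifies the average of `Z` as `visProb`.
  have h2 := sum_mul_filter (p := Relevant G l a) G.edges (fun _ => 1) Z (fun _ _ _ _ => rfl)
  simp only [one_mul, Finset.sum_const, nsmul_eq_mul, mul_one] at h2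
  rw [Finset.sum_congr rfl fun σ hσ => by rw [← key σ hσ]] at h1
  rw [Finset.sum_congr rfl fun σ hσ => (key σ hσ).symm, sum_visType_indicator] at h2
  have h3 := card_orderings_pos (G.edges.filter (Relevant G l a))
  have h4 := card_orderings_pos G.edges
  have h5 : ∑ τ ∈ orderings (G.edges.filter (Relevant G l a)), Z τ =
      (orderings (G.edges.filter (Relevant G l a))).card * visProb G χ l T a := by
    apply mul_left_cancel₀ h4.ne'
    rw [← h2]
    ring
  apply mul_left_cancel₀ h3.ne'
  rw [h1, h5]
  ring

/-- The representative chosen for the type is isomorphic to the ball around `e`, and an isomorphism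
carries orderings to orderings and preserves visible types. A uniform ordering of all edges induces
a uniform ordering of the edges inside the ball, the only ones the exploration uses. -/
theorem visTypeDist_toReal (hl : 1 ≤ l) {e : Edge} (he : e ∈ G.edges) :
    (visTypeDist l (nbhdType G χ l e) T).toReal = visProb G χ l T e := by
  set X := (nbhdType G χ l e).out with hX
  obtain ⟨φ, hv, hed, hc, hr⟩ : RootedGraph.Iso X ⟨G.induce (G.edgeBall l e), χ, e⟩ :=
    Quotient.exact (Quotient.out_eq (nbhdType G χ l e))
  simp only at hv hed hc hr
  have hroot : X.root.src ∈ X.graph.verts ∧ X.root.dst ∈ X.graph.verts := by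
    have h1 : ∀ v, φ v ∈ (G.induce (G.edgeBall l e)).verts → v ∈ X.graph.verts := by
      intro v hv'
      rw [← hv] at hv'
      simpa using hv'
    constructor
    · refine h1 _ ?_
      have : φ X.root.src = e.src := congrArg Edge.src hr
      rw [this]
      exact Finset.mem_inter.2 ⟨G.src_mem e he, src_mem_edgeBall (G.src_mem e he) l⟩
    · refine h1 _ ?_
      have : φ X.root.dst = e.dst := congrArg Edge.dst hr
      rw [this]
      exact Finset.mem_inter.2 ⟨G.dst_mem e he, dst_mem_edgeBall (G.dst_mem e he) l⟩
  have hdist : (visTypeDist l (nbhdType G χ l e) T).toReal =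
      (∑ σ ∈ orderings X.graph.edges, ind (visType X.color σ l X.root = T)) /
        (orderings X.graph.edges).card := by
    rw [visTypeDist, ← hX, ← PMF.toOuterMeasure_apply_singleton, PMF.toOuterMeasure_map_apply,
      uniformOrdering, PMF.toOuterMeasure_uniformOfFinset_apply, ENNReal.toReal_div,
      ENNReal.toReal_natCast, ENNReal.toReal_natCast, sum_ind]
    rfl
  have hsum : (∑ σ ∈ orderings X.graph.edges, ind (visType X.color σ l X.root = T))
      = ∑ τ ∈ orderings (G.induce (G.edgeBall l e)).edges,
        ind (visType χ τ l e = T) := by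
    rw [← hed, sum_orderings_map]
    refine Finset.sum_congr rfl fun σ hσ => ?_
    have hmem : ∀ f ∈ σ, f ∈ X.graph.edges := fun f hf => (mem_of_mem_orderings hσ).1 hf
    rw [← hr, visType_relabel φ X.color χ l X.root σ ⟨hc _ hroot.1, hc _ hroot.2⟩]
    exact fun f hf => ⟨hc _ (X.graph.src_mem f (hmem f hf)), hc _ (X.graph.dst_mem f (hmem f hf))⟩
  have hcard : (orderings X.graph.edges).card =
      (orderings (G.induce (G.edgeBall l e)).edges).card := by
    rw [← hed, card_orderings_map]
  rw [hdist, hsum, hcard, visProb]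
  have h1 := sum_mul_filter (p := fun f => f.src ∈ G.edgeBall l e ∧ f.dst ∈ G.edgeBall l e)
    G.edges (fun _ => 1) (fun τ => ind (visType χ τ l e = T)) (fun _ _ _ _ => rfl)
  simp only [one_mul, Finset.sum_const, nsmul_eq_mul, mul_one] at h1
  rw [Finset.sum_congr rfl (g := fun σ => ind (visType χ σ l e = T))
    fun σ hσ => by
      simp only [visType]
      rw [visNbhd_filter_edgeBall hl he fun g hg => (mem_of_mem_orderings hσ).1 hg]] at h1
  have h3 := card_orderings_pos (G.induce (G.edgeBall l e)).edges
  have h4 := card_orderings_pos G.edges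
  rw [div_eq_div_iff h3.ne' h4.ne', mul_comm, mul_comm _ (Nat.cast _)]
  exact h1.symm

theorem ofMultiset_apply' (hE : G.edges ≠ 0) (e : Edge) :
    PMF.ofMultiset G.edges hE e = (G.edges.count e : ENNReal) / Multiset.card G.edges := by
  rw [PMF.ofMultiset_apply]
  congr!

theorem edgeVisDist_toReal (hl : 1 ≤ l) (hE : G.edges ≠ 0) :
    (edgeVisDist G χ l hE T).toReal = typeProb G χ l T := by
  rw [edgeVisDist, edgeDist, PMF.bind_map, PMF.bind_apply,
    tsum_eq_sum (s := G.edges.toFinset), ENNReal.toReal_sum, typeProb, Finset.sum_div]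
  · refine Finset.sum_congr rfl fun e he => ?_
    rw [ofMultiset_apply', ENNReal.toReal_mul, Function.comp_apply,
      visTypeDist_toReal hl (Multiset.mem_toFinset.1 he), ENNReal.toReal_div,
      ENNReal.toReal_natCast, ENNReal.toReal_natCast, div_mul_eq_mul_div]
  · exact fun e _ => ENNReal.mul_ne_top (PMF.apply_ne_top _ _) (PMF.apply_ne_top _ _)
  · intro e he
    rw [ofMultiset_apply', Multiset.count_eq_zero_of_notMem (by simpa using he)]
    simp

/-! ### First and second moments -/

/-- The indicator of the event that the edge at position `i` has visible type `T`. -/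
noncomputable def hit (χ : ℕ → Fin k) (l : ℕ) (T : GraphType k) (i : ℕ) (σ : List Edge) : ℝ :=
  ind (∃ a, σ[i]? = some a ∧ visType χ σ l a = T)

theorem hit_eq_sum {E : Multiset Edge} {σ : List Edge} (hσ : σ ∈ orderings E) (i : ℕ) :
    hit χ l T i σ = ∑ a ∈ E.toFinset, (if σ[i]? = some a then (1 : ℝ) else 0) *
      ind (visType χ σ l a = T) := by
  cases h : σ[i]? with
  | none => simp [hit, h, ind]
  | some b =>
    have hb : b ∈ E.toFinset :=
      Multiset.mem_toFinset.2 ((mem_of_mem_orderings hσ).1 (List.mem_of_getElem? h))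
    rw [Finset.sum_eq_single b]
    · simp [hit, h, ind]
    · intro a _ hab
      simp [hab.symm]
    · exact fun hb' => absurd hb hb'

theorem getElem?_refill_iff {p : Edge → Prop} [DecidablePred p] {E : Multiset Edge}
    {σ τ : List Edge} (hσ : σ ∈ orderings E) (hτ : τ ∈ orderings (E.filter p)) {a : Edge}
    (ha : ¬ p a) (i : ℕ) : (refill p σ τ)[i]? = some a ↔ σ[i]? = some a :=
  (refill_spec' hσ hτ).2.2.2 a ha i

/-- Reordering the edges relevant to `a` leaves the position of `a` alone, so position and visible
type are independent. Each edge is at position `i` with probability proportional to its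
multiplicity, which makes every position an unbiased sample. -/
theorem sum_hit (hl : 1 ≤ l) {i : ℕ} (hi : i < Multiset.card G.edges) :
    ∑ σ ∈ orderings G.edges, hit χ l T i σ = typeProb G χ l T * (orderings G.edges).card := by
  have hm : (0 : ℝ) < Multiset.card G.edges := Nat.cast_pos.2 (by omega)
  rw [Finset.sum_congr rfl fun σ hσ => hit_eq_sum hσ i, Finset.sum_comm, typeProb, Finset.sum_div,
    Finset.sum_mul]
  refine Finset.sum_congr rfl fun a ha => ?_
  have ha' := Multiset.mem_toFinset.1 ha
  rw [sum_mul_visType_indicator hl ha']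
  · have h1 := card_orderings_position G.edges ha' hi
    rw [Finset.card_filter] at h1
    have h2 : (Multiset.card G.edges : ℝ) *
        ∑ σ ∈ orderings G.edges, (if σ[i]? = some a then (1 : ℝ) else 0) =
        G.edges.count a * (orderings G.edges).card := by exact_mod_cast h1
    rw [div_mul_eq_mul_div, eq_div_iff hm.ne']
    linear_combination visProb G χ l T a * h2
  · intro σ hσ τ hτ
    simp only [getElem?_refill_iff hσ hτ (fun h : Relevant G l a a => h.1 rfl)]

/-! ### Pairs of edges: independence at a distance and the covariance bound -/

/-- The edges `a` and `b` have disjoint neighborhoods. -/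
def Far (G : DiMultigraph) (l : ℕ) (a b : Edge) : Prop :=
  Disjoint (G.edgeBall l a) (G.edgeBall l b)

theorem Far.symm {a b : Edge} (h : Far G l a b) : Far G l b a := Disjoint.symm h

theorem Far.not_relevant {a b : Edge} (h : Far G l a b) (hb : b ∈ G.edges) :
    ¬ Relevant G l a b := fun hr =>
  Finset.disjoint_left.1 h hr.2.1 (src_mem_edgeBall (G.src_mem b hb) l)

theorem Far.relevant_disjoint {a b : Edge} (h : Far G l a b) (f : Edge)
    (hf : Relevant G l b f) : ¬ Relevant G l a f := fun hr =>
  Finset.disjoint_left.1 h hr.2.1 hf.2.1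

/-- If the two balls meet in `w`, then an end of `b` is within `l` of `w`. So all near edges touch
the union of the `l`-balls around the points of the ball of `a`, a set of bounded size. -/
theorem card_not_far_le {D : ℕ} (hG : G.IsBounded D) (a : Edge) :
    Multiset.card (G.edges.filter fun b => ¬ Far G l a b) ≤
      2 * (D + 1) ^ l * (D + 1) ^ l * D := by
  refine (countP_touch_le hG (Multiset.filter_le _ _) ((G.edgeBall l a).biUnion (G.ball l))
    ?_ ?_).trans (Nat.mul_le_mul_right _ ?_)
  · intro v hv
    obtain ⟨w, _, hw⟩ := Finset.mem_biUnion.1 hv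
    exact (mem_ball.1 hw).1
  · intro b hb
    obtain ⟨hb, hnf⟩ := Multiset.mem_filter.1 hb
    obtain ⟨w, hwa, hwb⟩ := Finset.not_disjoint_iff.1 hnf
    rcases mem_edgeBall.1 hwb with h | h
    · exact Or.inl (Finset.mem_biUnion.2 ⟨w, hwa, mem_ball_comm (G.src_mem b hb) h⟩)
    · exact Or.inr (Finset.mem_biUnion.2 ⟨w, hwa, mem_ball_comm (G.dst_mem b hb) h⟩)
  · exact (Finset.card_biUnion_le_card_mul _ _ _ fun w _ => card_ball_le hG l w).trans
      (Nat.mul_le_mul_right _ (card_edgeBall_le hG l a))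

theorem sum_two_positions_le (E : Multiset Edge) (hm : 2 ≤ Multiset.card E) {a b : Edge}
    (ha : a ∈ E) (hb : b ∈ E) {i j : ℕ} (hi : i < Multiset.card E) (hj : j < Multiset.card E)
    (hij : i ≠ j) :
    ∑ σ ∈ orderings E, (if σ[i]? = some a then (1 : ℝ) else 0) * (if σ[j]? = some b then 1 else 0) ≤
      (orderings E).card / (Multiset.card E * (Multiset.card E - 1)) *
        (E.count a * E.count b) := by
  have h1 := card_orderings_two_positions_le E ha hb hi hj hij
  have h2 : ∑ σ ∈ orderings E, (if σ[i]? = some a then (1 : ℝ) else 0) *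
      (if σ[j]? = some b then 1 else 0) =
      (((orderings E).filter fun σ => σ[i]? = some a ∧ σ[j]? = some b).card : ℝ) := by
    rw [Finset.card_filter]
    push_cast
    refine Finset.sum_congr rfl fun σ _ => ?_
    rw [ite_and]
    split_ifs <;> simp
  rw [h2]
  have h3 : (2 : ℝ) ≤ Multiset.card E := by exact_mod_cast hm
  have h4 : (0 : ℝ) < Multiset.card E * (Multiset.card E - 1) := by nlinarith
  rw [div_mul_eq_mul_div, le_div_iff₀ h4]
  have h5 : ((Multiset.card E * (Multiset.card E - 1) * ((orderings E).filter fun σ =>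
      σ[i]? = some a ∧ σ[j]? = some b).card : ℕ) : ℝ) ≤
      ((E.count a * E.count b * (orderings E).card : ℕ) : ℝ) := by exact_mod_cast h1
  push_cast [Nat.cast_sub (show 1 ≤ Multiset.card E by omega)] at h5
  linarith

/-- Reordering the edges relevant to `a` fixes both positions, since `b` is not relevant to `a`, and
also the visible type of `b`, since no edge is relevant to both. This splits off the factor for `a`;
reordering around `b` then splits off the other one. -/
theorem sum_pair_far (hl : 1 ≤ l) {a b : Edge} (ha : a ∈ G.edges) (hb : b ∈ G.edges)
    (hab : Far G l a b) (i j : ℕ) :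
    ∑ σ ∈ orderings G.edges, ((if σ[i]? = some a then (1 : ℝ) else 0) *
      ind (visType χ σ l a = T)) * ((if σ[j]? = some b then (1 : ℝ) else 0) *
      ind (visType χ σ l b = T)) =
    visProb G χ l T a * visProb G χ l T b * ∑ σ ∈ orderings G.edges,
      (if σ[i]? = some a then (1 : ℝ) else 0) * (if σ[j]? = some b then 1 else 0) := by
  have hnaa : ¬ Relevant G l a a := fun h => h.1 rfl
  have hnbb : ¬ Relevant G l b b := fun h => h.1 rfl
  have h1 := sum_mul_visType_indicator (χ := χ) (T := T) hl ha
    (fun σ => ((if σ[i]? = some a then (1 : ℝ) else 0) * (if σ[j]? = some b then 1 else 0)) *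
      ind (visType χ σ l b = T)) (by
    intro σ hσ τ hτ
    have hv : visNbhd l b (refill (Relevant G l a) σ τ) = visNbhd l b σ := by
      have hm := refill_mem_orderings hσ hτ
      refine visNbhd_congr hl hb (fun g hg => (mem_of_mem_orderings hm).1 hg)
        (fun g hg => (mem_of_mem_orderings hσ).1 hg) ?_ ?_
      · rw [count_of_mem_orderings hm, count_of_mem_orderings hσ]
      · exact refill_filter_of_disjoint hσ hτ fun f hf => hab.relevant_disjoint f hf
    simp only [getElem?_refill_iff hσ hτ hnaa, getElem?_refill_iff hσ hτ (hab.not_relevant hb),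
      visType, hv])
  have h2 := sum_mul_visType_indicator (χ := χ) (T := T) hl hb
    (fun σ => (if σ[i]? = some a then (1 : ℝ) else 0) * (if σ[j]? = some b then 1 else 0)) (by
    intro σ hσ τ hτ
    simp only [getElem?_refill_iff hσ hτ hnbb, getElem?_refill_iff hσ hτ (hab.symm.not_relevant ha)])
  rw [h2] at h1
  rw [mul_assoc, ← h1]
  refine Finset.sum_congr rfl fun σ _ => ?_
  ring

/-- Far pairs factor by independence. Near pairs are bounded trivially, and with multiplicity there
are at most `B` of them for each first edge, among the `m (m - 1)` pairs over which two positions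
range. -/
theorem sum_hit_mul_hit_le (hl : 1 ≤ l) {D : ℕ} (hG : G.IsBounded D)
    (hm : 2 ≤ Multiset.card G.edges) {i j : ℕ} (hi : i < Multiset.card G.edges)
    (hj : j < Multiset.card G.edges) (hij : i ≠ j) :
    ∑ σ ∈ orderings G.edges, hit χ l T i σ * hit χ l T j σ ≤
      (orderings G.edges).card * (typeProb G χ l T ^ 2 +
        (1 + 2 * (D + 1) ^ l * (D + 1) ^ l * D) / (Multiset.card G.edges - 1)) := by
  set E := G.edges with hE
  set m : ℝ := (Multiset.card E : ℝ) with hmdef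
  set O : ℝ := ((orderings E).card : ℝ) with hO
  set p := typeProb G χ l T with hp
  set B : ℝ := 2 * (D + 1) ^ l * (D + 1) ^ l * D with hB
  have hm2 : (2 : ℝ) ≤ m := by rw [hmdef]; exact_mod_cast hm
  have hO0 : 0 < O := card_orderings_pos E
  have hκ : 0 ≤ O / (m * (m - 1)) := div_nonneg hO0.le (by nlinarith)
  -- The product term is granted to near pairs as well, so that its double sum factors as `(m * p) *
  -- (m * p)`.
  have hterm : ∀ a ∈ E.toFinset, ∀ b ∈ E.toFinset,
      ∑ σ ∈ orderings E, ((if σ[i]? = some a then (1 : ℝ) else 0) *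
      ind (visType χ σ l a = T)) * ((if σ[j]? = some b then (1 : ℝ) else 0) *
      ind (visType χ σ l b = T)) ≤
      O / (m * (m - 1)) * ((E.count a * visProb G χ l T a) * (E.count b * visProb G χ l T b)) +
      O / (m * (m - 1)) * (E.count a * if Far G l a b then 0 else (E.count b : ℝ)) := by
    intro a ha b hb
    rw [Multiset.mem_toFinset] at ha hb
    have h1 := sum_two_positions_le E hm ha hb hi hj hij
    have hqa := visProb_nonneg (G := G) (χ := χ) (l := l) (T := T) a
    have hqb := visProb_nonneg (G := G) (χ := χ) (l := l) (T := T) b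
    by_cases hf : Far G l a b
    · rw [sum_pair_far hl ha hb hf, if_pos hf, mul_zero, mul_zero, add_zero]
      refine (mul_le_mul_of_nonneg_left h1 (mul_nonneg hqa hqb)).trans (le_of_eq ?_)
      ring
    · rw [if_neg hf]
      refine le_trans ?_ (le_add_of_nonneg_left (mul_nonneg hκ (by positivity)))
      refine le_trans (Finset.sum_le_sum fun σ _ => ?_) h1
      refine mul_le_mul (mul_le_of_le_one_right ?_ (ind_le_one _))
        (mul_le_of_le_one_right ?_ (ind_le_one _)) (mul_nonneg ?_ (ind_nonneg _)) ?_ <;>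
        split_ifs <;> norm_num
  have hnear : ∀ a, ∑ b ∈ E.toFinset, (if Far G l a b then 0 else (E.count b : ℝ)) ≤ B := by
    intro a
    have h1 := card_not_far_le (l := l) hG a
    have h2 : Multiset.card (E.filter fun b => ¬ Far G l a b) =
        ∑ b ∈ E.toFinset, if Far G l a b then 0 else E.count b := by
      rw [← Multiset.toFinset_sum_count_eq, Multiset.toFinset_filter, Finset.sum_filter]
      refine Finset.sum_congr rfl fun b _ => ?_
      by_cases hf : Far G l a b <;> simp [hf]
    rw [← hE, h2] at h1
    rw [hB]
    exact_mod_cast h1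
  have hmp : ∑ a ∈ E.toFinset, (E.count a : ℝ) * visProb G χ l T a = m * p := by
    rw [hp, typeProb, mul_div_cancel₀]
    positivity
  calc ∑ σ ∈ orderings E, hit χ l T i σ * hit χ l T j σ
      = ∑ a ∈ E.toFinset, ∑ b ∈ E.toFinset, ∑ σ ∈ orderings E,
        ((if σ[i]? = some a then (1 : ℝ) else 0) *
        ind (visType χ σ l a = T)) * ((if σ[j]? = some b then (1 : ℝ) else 0) *
        ind (visType χ σ l b = T)) := by
        rw [Finset.sum_congr rfl fun σ hσ => by
          rw [hit_eq_sum hσ i, hit_eq_sum hσ j, Finset.sum_mul_sum], Finset.sum_comm]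
        exact Finset.sum_congr rfl fun a _ => Finset.sum_comm
    _ ≤ ∑ a ∈ E.toFinset, ∑ b ∈ E.toFinset,
      (O / (m * (m - 1)) * ((E.count a * visProb G χ l T a) * (E.count b * visProb G χ l T b)) +
      O / (m * (m - 1)) * (E.count a * if Far G l a b then 0 else (E.count b : ℝ))) :=
        Finset.sum_le_sum fun a ha => Finset.sum_le_sum fun b hb => hterm a ha b hb
    _ = O / (m * (m - 1)) * ((m * p) * (m * p)) + O / (m * (m - 1)) * ∑ a ∈ E.toFinset,
        (E.count a * ∑ b ∈ E.toFinset, if Far G l a b then 0 else (E.count b : ℝ)) := by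
        rw [← hmp, Finset.sum_mul_sum]
        simp only [Finset.sum_add_distrib, ← Finset.mul_sum]
    _ ≤ O / (m * (m - 1)) * ((m * p) * (m * p)) + O / (m * (m - 1)) * (m * B) := by
        refine add_le_add_right (mul_le_mul_of_nonneg_left ?_ hκ) _
        rw [hmdef, ← sum_count_toFinset, Finset.sum_mul]
        exact Finset.sum_le_sum fun a _ => mul_le_mul_of_nonneg_left (hnear a) (Nat.cast_nonneg _)
    -- Sampling without replacement costs the factor m/(m-1) = 1 + 1/(m-1) on `p ^ 2`; the extra
    -- term becomes the `1` in `1 + B`.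
    _ = O * (p ^ 2 + (p ^ 2 + B) / (m - 1)) := by
        have : m - 1 ≠ 0 := by linarith
        have : m ≠ 0 := by linarith
        field_simp
        ring
    _ ≤ O * (p ^ 2 + (1 + B) / (m - 1)) := by
        refine mul_le_mul_of_nonneg_left (add_le_add_right ?_ _) hO0.le
        refine div_le_div_of_nonneg_right (add_le_add_left ?_ _) (by linarith)
        exact pow_le_one₀ typeProb_nonneg typeProb_le_one

/-! ### Variance of the sampled frequencies and Chebyshev's inequality -/

/-- The fraction of the first `s` edges that have visible type `T`. -/
noncomputable def freq (χ : ℕ → Fin k) (l : ℕ) (T : GraphType k) (s : ℕ) (σ : List Edge) : ℝ :=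
  (∑ i ∈ Finset.range s, hit χ l T i σ) / s

theorem hit_sq_le_one (i : ℕ) (σ : List Edge) : hit χ l T i σ * hit χ l T i σ ≤ 1 := by
  exact mul_le_one₀ (ind_le_one _) (ind_nonneg _) (ind_le_one _)

/-- The `s` diagonal terms of the squared sum contribute 1/s after normalization. The off-diagonal
terms contribute `p ^ 2`, which cancels against the mean, plus the covariance error. -/
theorem sum_freq_sub_sq_le (hl : 1 ≤ l) {D : ℕ} (hG : G.IsBounded D)
    (hm : 2 ≤ Multiset.card G.edges) {s : ℕ} (hs : 1 ≤ s) (hsm : s ≤ Multiset.card G.edges) :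
    ∑ σ ∈ orderings G.edges, (freq χ l T s σ - typeProb G χ l T) ^ 2 ≤
      (orderings G.edges).card * (1 / s +
        (1 + 2 * (D + 1) ^ l * (D + 1) ^ l * D) / (Multiset.card G.edges - 1)) := by
  set O : ℝ := ((orderings G.edges).card : ℝ) with hO
  set p := typeProb G χ l T with hp
  set κ : ℝ := (1 + 2 * (D + 1) ^ l * (D + 1) ^ l * D) / (Multiset.card G.edges - 1) with hκ
  have hO0 : 0 < O := card_orderings_pos _
  have hs0 : (0 : ℝ) < s := Nat.cast_pos.2 hs
  have hm2 : (2 : ℝ) ≤ Multiset.card G.edges := by exact_mod_cast hm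
  have hκ0 : 0 ≤ κ := div_nonneg (by positivity) (by linarith)
  have h1 : ∑ σ ∈ orderings G.edges, ∑ i ∈ Finset.range s, hit χ l T i σ = s * (p * O) := by
    rw [Finset.sum_comm, Finset.sum_congr rfl fun i hi =>
      sum_hit hl ((Finset.mem_range.1 hi).trans_le hsm)]
    simp [hp, hO]
  have h2 : ∑ σ ∈ orderings G.edges, (∑ i ∈ Finset.range s, hit χ l T i σ) ^ 2 ≤
      s ^ 2 * (O * (p ^ 2 + κ)) + s * O := by
    have h3 : ∑ σ ∈ orderings G.edges, (∑ i ∈ Finset.range s, hit χ l T i σ) ^ 2 =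
        ∑ i ∈ Finset.range s, ∑ j ∈ Finset.range s, ∑ σ ∈ orderings G.edges,
          hit χ l T i σ * hit χ l T j σ := by
      rw [Finset.sum_congr rfl fun σ _ => by rw [sq, Finset.sum_mul_sum], Finset.sum_comm]
      exact Finset.sum_congr rfl fun a _ => Finset.sum_comm
    rw [h3]
    calc _ ≤ ∑ i ∈ Finset.range s, ∑ j ∈ Finset.range s,
          -- The off-diagonal bound is nonnegative and is charged on the diagonal too, which keeps
          -- the double sum in closed form.
          (O * (p ^ 2 + κ) + if i = j then O else 0) := by
          refine Finset.sum_le_sum fun i hi => Finset.sum_le_sum fun j hj => ?_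
          rw [Finset.mem_range] at hi hj
          by_cases hij : i = j
          · subst hij
            rw [if_pos rfl]
            refine le_trans ?_ (le_add_of_nonneg_left (by positivity))
            refine (Finset.sum_le_card_nsmul _ _ 1 fun σ _ => hit_sq_le_one i σ).trans ?_
            simp [hO]
          · rw [if_neg hij, add_zero]
            exact sum_hit_mul_hit_le hl hG hm (hi.trans_le hsm) (hj.trans_le hsm) hij
      _ = _ := by
          simp only [Finset.sum_add_distrib, Finset.sum_const, Finset.card_range, nsmul_eq_mul,
            Finset.sum_ite_eq, Finset.mem_range]
          rw [Finset.sum_congr rfl fun i hi => if_pos (Finset.mem_range.1 hi)]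
          simp
          ring
  have h4 : ∑ σ ∈ orderings G.edges, (freq χ l T s σ - p) ^ 2 =
      (∑ σ ∈ orderings G.edges, (∑ i ∈ Finset.range s, hit χ l T i σ) ^ 2) / s ^ 2 -
      2 * p / s * (∑ σ ∈ orderings G.edges, ∑ i ∈ Finset.range s, hit χ l T i σ) + O * p ^ 2 := by
    rw [Finset.sum_div, Finset.mul_sum, ← Finset.sum_sub_distrib, hO, ← nsmul_eq_mul,
      ← Finset.sum_const, ← Finset.sum_add_distrib]
    refine Finset.sum_congr rfl fun σ _ => ?_
    rw [freq]
    field_simp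
    ring
  rw [h4, h1]
  calc _ ≤ (s ^ 2 * (O * (p ^ 2 + κ)) + s * O) / s ^ 2 - 2 * p / s * (s * (p * O)) + O * p ^ 2 := by
        gcongr
    _ = O * (1 / s + κ) := by
        field_simp
        ring

theorem card_freq_far_le (hl : 1 ≤ l) {D : ℕ} (hG : G.IsBounded D)
    (hm : 2 ≤ Multiset.card G.edges) {s : ℕ} (hs : 1 ≤ s) (hsm : s ≤ Multiset.card G.edges)
    {η : ℝ} (hη : 0 < η) :
    (((orderings G.edges).filter fun σ => η < |freq χ l T s σ - typeProb G χ l T|).card : ℝ) ≤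
      (orderings G.edges).card * ((1 / s +
        (1 + 2 * (D + 1) ^ l * (D + 1) ^ l * D) / (Multiset.card G.edges - 1)) / η ^ 2) := by
  rw [← mul_div_assoc, le_div_iff₀ (by positivity)]
  refine le_trans ?_ (sum_freq_sub_sq_le (χ := χ) (T := T) hl hG hm hs hsm)
  rw [← nsmul_eq_mul, ← Finset.sum_const]
  refine (Finset.sum_le_sum fun σ hσ => ?_).trans
    (Finset.sum_le_sum_of_subset_of_nonneg (Finset.filter_subset _ _) fun σ _ _ => sq_nonneg _)
  rw [← sq_abs (freq χ l T s σ - _)]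
  exact pow_le_pow_left₀ hη.le (Finset.mem_filter.1 hσ).2.le 2

end

end DicutStream

namespace DicutStream

open DiMultigraph

/-! ### There are finitely many types -/

/-- Number the vertices consecutively from zero; they all lie in the ball around the root, whose
size is bounded. The multiplicity of an edge is at most the out-degree of its source. -/
theorem exists_small_representative {k l D : ℕ} {T : GraphType k} (hT : T ∈ boundedTypes k l D) :
    ∃ X : RootedGraph k, typeOf X.graph X.color X.root = T ∧
      (∀ v ∈ X.graph.verts, v < 2 * (D + 1) ^ l) ∧ (∀ e, X.graph.edges.count e < D + 1) ∧
      X.root ∈ X.graph.edges := by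
  obtain ⟨X, rfl, hroot, hD, hball⟩ := hT
  obtain ⟨φ, hφ⟩ := exists_perm_of_eq_iff (fun v : X.graph.verts => (v : ℕ))
    (fun v => (X.graph.verts.equivFin v : ℕ)) (fun v w => by
      rw [Fin.val_inj, EmbeddingLike.apply_eq_iff_eq, Subtype.ext_iff])
  refine ⟨⟨X.graph.relabel φ, fun v => X.color (φ.symm v), X.root.map φ⟩, ?_, ?_, ?_, ?_⟩
  · exact typeOf_relabel φ X.graph X.color _ X.root fun v _ => by simp
  · intro v hv
    obtain ⟨w, hw, rfl⟩ := Finset.mem_map.1 hv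
    have h1 : φ w = _ := hφ ⟨w, hw⟩
    rw [Equiv.coe_toEmbedding, h1]
    exact (Fin.is_lt _).trans_le ((Finset.card_le_card hball).trans (card_edgeBall_le hD l _))
  · intro e
    rw [← Edge.map_map_symm φ e]
    simp only [relabel]
    rw [Multiset.count_map_eq_count' _ _ (Edge.map_injective φ), Nat.lt_succ_iff]
    by_cases he : Edge.map φ.symm e ∈ X.graph.edges
    · refine le_trans ?_ (hD _ (X.graph.src_mem _ he))
      refine le_trans ?_ (Nat.le_add_left _ _)
      rw [Multiset.count, Multiset.countP_eq_card_filter, Multiset.countP_eq_card_filter]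
      refine Multiset.card_le_card (Multiset.monotone_filter_right _ ?_)
      rintro f rfl
      rfl
    · rw [Multiset.count_eq_zero_of_notMem he]
      exact Nat.zero_le _
  · exact Multiset.mem_map_of_mem _ hroot.1

instance finite_boundedTypes (k l D : ℕ) : Finite (boundedTypes k l D) := by
  classical
  have h := fun T : boundedTypes k l D => exists_small_representative T.2
  choose X hX hv hc hr using h
  have hs : ∀ T, ∀ e ∈ (X T).graph.edges, e.src < 2 * (D + 1) ^ l ∧ e.dst < 2 * (D + 1) ^ l :=
    fun T e he => ⟨hv T _ ((X T).graph.src_mem e he), hv T _ ((X T).graph.dst_mem e he)⟩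
  -- A small representative is determined up to isomorphism by its vertex set, edge multiplicities,
  -- colors and root, all recorded in a finite type.
  let code : boundedTypes k l D → (Fin (2 * (D + 1) ^ l) → Prop) ×
      (Fin (2 * (D + 1) ^ l) → Fin (2 * (D + 1) ^ l) → Fin (D + 1)) ×
      (Fin (2 * (D + 1) ^ l) → Fin k) × Fin (2 * (D + 1) ^ l) × Fin (2 * (D + 1) ^ l) := fun T =>
    (fun v => (v : ℕ) ∈ (X T).graph.verts,
      fun u v => if h : (u : ℕ) ≠ v then ⟨(X T).graph.edges.count ⟨u, v, h⟩, hc T _⟩ else 0,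
      fun v => (X T).color v,
      ⟨(X T).root.src, (hs T _ (hr T)).1⟩, ⟨(X T).root.dst, (hs T _ (hr T)).2⟩)
  refine Finite.of_injective code fun S T hST => ?_
  simp only [code, Prod.mk.injEq, funext_iff, Fin.mk.injEq, eq_iff_iff] at hST
  obtain ⟨h1, h2, h3, h4, h5⟩ := hST
  have hverts : (X S).graph.verts = (X T).graph.verts := by
    ext v
    by_cases hvB : v < 2 * (D + 1) ^ l
    · exact h1 ⟨v, hvB⟩
    · exact ⟨fun h => absurd (hv S v h) hvB, fun h => absurd (hv T v h) hvB⟩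
  have hedges : (X S).graph.edges = (X T).graph.edges := by
    ext e
    by_cases he : e.src < 2 * (D + 1) ^ l ∧ e.dst < 2 * (D + 1) ^ l
    · have := h2 ⟨e.src, he.1⟩ ⟨e.dst, he.2⟩
      simpa [e.ne] using this
    · rw [Multiset.count_eq_zero_of_notMem fun h => he (hs S e h),
        Multiset.count_eq_zero_of_notMem fun h => he (hs T e h)]
  have hgraph : (X S).graph = (X T).graph := DiMultigraph.ext hverts hedges
  apply Subtype.ext
  rw [← hX S, ← hX T]
  refine Quotient.sound ⟨Equiv.refl ℕ, ?_, ?_, ?_, Edge.ext h4 h5⟩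
  · simp [hgraph]
  · rw [show Edge.map (Equiv.refl ℕ) = id from rfl, Multiset.map_id]
    exact hedges
  · intro v hvS
    exact h3 ⟨v, hv S v hvS⟩

end DicutStream

namespace DicutStream

/-! ### A machine that stores a bounded sublist of the stream -/

/-- The list stored after reading one more edge. -/
noncomputable def storeStep (keep : List Edge → Edge → Prop) (L : List Edge) (f : Edge) :
    List Edge :=
  open Classical in if keep L f then L ++ [f] else L

/-- The list stored after reading a stream. -/
noncomputable def store (keep : List Edge → Edge → Prop) (σ : List Edge) : List Edge :=
  σ.foldl (storeStep keep) []

theorem length_le_foldl_storeStep (keep : List Edge → Edge → Prop) (σ L : List Edge) :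
    L.length ≤ (σ.foldl (storeStep keep) L).length := by
  induction σ generalizing L with
  | nil => exact le_rfl
  | cons f σ ih =>
    refine le_trans ?_ (ih _)
    unfold storeStep
    split_ifs <;> simp

/-- The source (`false`) or the destination (`true`) of an edge. -/
def Edge.endpoint (e : Edge) : Bool → ℕ
  | false => e.src
  | true => e.dst

/-- The stages of the computation. -/
inductive Phase
  | reading
  | deciding
  | writing
  | done
  deriving DecidableEq

instance : Fintype Phase :=
  ⟨{Phase.reading, Phase.deciding, Phase.writing, Phase.done}, fun x => by cases x <;> decide⟩

/-- Registers for the number of vertices, the two endpoints of the current edge, the endpoints of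
up to `K` stored edges, and the output. -/
abbrev StoreReg (K : ℕ) (T : Type) : Type := Fin 3 ⊕ (Fin K × Bool) ⊕ T

namespace StoreReg

variable {K : ℕ} {T : Type}

/-- The register that initially holds the number of vertices. -/
abbrev size : StoreReg K T := Sum.inl 0

/-- The register of the source of the current edge. -/
abbrev src : StoreReg K T := Sum.inl 1

/-- The register of the destination of the current edge. -/
abbrev dst : StoreReg K T := Sum.inl 2

/-- The register of an endpoint of a stored edge. -/
abbrev slot (i : Fin K) (b : Bool) : StoreReg K T := Sum.inr (Sum.inl (i, b))

/-- The register of an output weight. -/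
abbrev out (t : T) : StoreReg K T := Sum.inr (Sum.inr t)

end StoreReg

open StoreReg

section

variable {k K : ℕ} {T : Type}

/-- The registers contain the list `L`. -/
def Holds (mem : StoreReg K T → ℕ) (L : List Edge) : Prop :=
  ∀ (i : Fin K) (e : Edge), L[(i : ℕ)]? = some e → ∀ b, mem (slot i b) = e.endpoint b

theorem Holds.eq_map {mem mem' : StoreReg K T → ℕ} {L L' : List Edge} (h : Holds mem L)
    (h' : Holds mem' L') (hlen : L.length = L'.length) (hK : L.length ≤ K) {φ : Equiv.Perm ℕ}
    (hφ : ∀ i, φ (mem i) = mem' i) : L' = L.map (Edge.map φ) := by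
  refine List.ext_getElem (by simp [hlen]) fun i hi' hi => ?_
  have hi1 : i < L.length := by omega
  rw [List.getElem_map]
  have h1 := h ⟨i, by omega⟩ _ (List.getElem?_eq_getElem hi1)
  have h2 := h' ⟨i, by omega⟩ _ (List.getElem?_eq_getElem hi')
  refine Edge.ext ?_ ?_
  · exact (h2 false).symm.trans ((hφ _).symm.trans (congrArg φ (h1 false)))
  · exact (h2 true).symm.trans ((hφ _).symm.trans (congrArg φ (h1 true)))

theorem exists_perm_of_same_order {R : Type} [Finite R] {mem mem' : R → ℕ}
    (h : ∀ i j, decide (mem i ≤ mem j) = decide (mem' i ≤ mem' j)) :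
    ∃ φ : Equiv.Perm ℕ, ∀ i, φ (mem i) = mem' i :=
  exists_perm_of_eq_iff mem mem' fun i j => by
    have h1 := decide_eq_decide.1 (h i j)
    have h2 := decide_eq_decide.1 (h j i)
    omega

/-! ### Decisions as functions of comparisons and colors -/

/-- The comparisons between the registers indicate that the current edge is to be stored. -/
def KeepCode (keep : List Edge → Edge → Prop) (c : ℕ)
    (cmp : StoreReg K T → StoreReg K T → Bool) : Prop :=
  ∃ (mem : StoreReg K T → ℕ) (L : List Edge) (f : Edge), L.length = c ∧ Holds mem L ∧
    mem src = f.src ∧ mem dst = f.dst ∧ (∀ i j, decide (mem i ≤ mem j) = cmp i j) ∧ keep L f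

/-- Two memories with the same comparisons differ by a permutation of the naturals. It maps one
stored list and current edge to the other, so by invariance it does not matter which witness
`KeepCode` supplies. -/
theorem keepCode_iff [Finite T] {keep : List Edge → Edge → Prop}
    (hkeep : ∀ φ L f, keep (L.map (Edge.map φ)) (f.map φ) ↔ keep L f)
    {mem : StoreReg K T → ℕ} {L : List Edge} {f : Edge} (hL : Holds mem L) (hK : L.length ≤ K)
    (hs : mem src = f.src) (hd : mem dst = f.dst) :
    KeepCode keep L.length (fun i j => decide (mem i ≤ mem j)) ↔ keep L f := by
  constructor
  · rintro ⟨mem', L', f', hlen, hL', hs', hd', hcmp, h⟩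
    obtain ⟨φ, hφ⟩ := exists_perm_of_same_order hcmp
    have h1 : L = L'.map (Edge.map φ) := hL'.eq_map hL hlen (by omega) hφ
    have h2 : f = f'.map φ := Edge.ext (by rw [← hs, ← hφ, hs']; rfl) (by rw [← hd, ← hφ, hd']; rfl)
    rwa [h1, h2, hkeep]
  · exact fun h => ⟨mem, L, f, rfl, hL, hs, hd, fun _ _ => rfl, h⟩

/-- The comparisons and colors of the registers determine the output weight `v` for `t`. -/
def WeightCode (wt : (ℕ → Fin k) → List Edge → T → ℕ) (c : ℕ)
    (cmp : StoreReg K T → StoreReg K T → Bool) (col : StoreReg K T → Option (Fin k)) (t : T)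
    (v : ℕ) : Prop :=
  ∃ (mem : StoreReg K T → ℕ) (L : List Edge) (χ : ℕ → Fin k), L.length = c ∧ Holds mem L ∧
    (∀ i j, decide (mem i ≤ mem j) = cmp i j) ∧
    (∀ (i : Fin K) e, L[(i : ℕ)]? = some e → ∀ b, col (slot i b) = some (χ (e.endpoint b))) ∧
    wt χ L t = v

open Classical in
/-- The output weight for `t`, as a function of the comparisons and colors of the registers. -/
noncomputable def weight (wt : (ℕ → Fin k) → List Edge → T → ℕ) (c : ℕ)
    (cmp : StoreReg K T → StoreReg K T → Bool) (col : StoreReg K T → Option (Fin k)) (t : T) : ℕ :=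
  if h : ∃ v, WeightCode wt c cmp col t v then h.choose else 0

/-- As for the storage rule, any two memories realizing the same comparisons are related by a
relabelling. The common color data makes that relabelling preserve the colors of all stored
endpoints. -/
theorem weight_eq [Finite T] {wt : (ℕ → Fin k) → List Edge → T → ℕ}
    (hwt : ∀ φ χ χ' L t, (∀ e ∈ L, ∀ b, χ (e.endpoint b) = χ' (φ (e.endpoint b))) →
      wt χ' (L.map (Edge.map φ)) t = wt χ L t)
    {mem : StoreReg K T → ℕ} {L : List Edge} {χ : ℕ → Fin k}
    {col : StoreReg K T → Option (Fin k)} (hL : Holds mem L) (hK : L.length ≤ K)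
    (hcol : ∀ (i : Fin K) e, L[(i : ℕ)]? = some e → ∀ b,
      col (slot i b) = some (χ (e.endpoint b))) (t : T) :
    weight wt L.length (fun i j => decide (mem i ≤ mem j)) col t = wt χ L t := by
  have h : ∃ v, WeightCode wt L.length (fun i j => decide (mem i ≤ mem j)) col t v :=
    ⟨_, mem, L, χ, rfl, hL, fun _ _ => rfl, hcol, rfl⟩
  rw [weight, dif_pos h]
  obtain ⟨mem', L', χ', hlen, hL', hcmp, hcol', h⟩ := h.choose_spec
  rw [← h]
  obtain ⟨φ, hφ⟩ := exists_perm_of_same_order hcmp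
  have h1 : L = L'.map (Edge.map φ) := hL'.eq_map hL hlen (by omega) hφ
  symm
  rw [h1]
  refine hwt φ χ' χ L' t fun e he b => ?_
  obtain ⟨i, hi, rfl⟩ := List.getElem_of_mem he
  have h2 := hcol' ⟨i, by omega⟩ _ (List.getElem?_eq_getElem hi) b
  have h3 := hcol ⟨i, by omega⟩ (L'[i].map φ) (by simp [h1, hi]) b
  rw [h2, Option.some.injEq] at h3
  rw [h3]
  cases b <;> rfl

/-- The assignment of the constants `w` to the output registers. -/
def writeExpr (w : T → ℕ) : StoreReg K T → Expr (StoreReg K T)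
  | Sum.inr (Sum.inr t) => Expr.const (w t)
  | r => Expr.reg r

theorem exists_weight_le [Finite T] (K : ℕ) (wt : (ℕ → Fin k) → List Edge → T → ℕ) :
    ∃ W, ∀ (c : Fin (K + 1)) (cmp : StoreReg K T → StoreReg K T → Bool)
      (col : StoreReg K T → Option (Fin k)) (t : T), weight wt c cmp col t ≤ W := by
  obtain ⟨W, hW⟩ := (Set.finite_range fun x : Fin (K + 1) × (StoreReg K T → StoreReg K T → Bool) ×
    (StoreReg K T → Option (Fin k)) × T => weight wt x.1 x.2.1 x.2.2.1 x.2.2.2).bddAbove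
  exact ⟨W, fun c cmp col t => hW ⟨(c, cmp, col, t), rfl⟩⟩

variable [Fintype T] [DecidableEq T]

/-! ### The machine, its run and its space -/

open Classical in
/-- The machine that stores edges according to `keep`, and outputs the weights `wt`. -/
noncomputable def storeMachine (K : ℕ) (keep : List Edge → Edge → Prop)
    (wt : (ℕ → Fin k) → List Edge → T → ℕ) : StreamMachine k T where
  Q := Phase × Fin (K + 1)
  R := StoreReg K T
  start := (Phase.reading, 0)
  sizeReg := size
  srcReg := src
  dstReg := dst
  outReg := out
  program q cmp col := match q with
    | (Phase.reading, c) => Command.read (Phase.deciding, c) (Phase.writing, c)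
    | (Phase.deciding, c) =>
      if h : KeepCode keep c cmp ∧ (c : ℕ) < K then
        Command.assign (fun r =>
          if r = slot ⟨c, h.2⟩ false then Expr.reg src
          else if r = slot ⟨c, h.2⟩ true then Expr.reg dst
          else Expr.reg r) (Phase.reading, ⟨c + 1, Nat.succ_lt_succ h.2⟩)
      else Command.assign Expr.reg (Phase.reading, c)
    | (Phase.writing, c) => Command.assign (writeExpr (weight wt c cmp col)) (Phase.done, c)
    | (Phase.done, _) => Command.halt

variable {keep : List Edge → Edge → Prop} {wt : (ℕ → Fin k) → List Edge → T → ℕ}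

-- The invariant is that the slots hold the current list and the control state holds its length. The
-- stored list never shrinks, so the bound on its final length guarantees a free slot whenever an
-- edge has to be stored.
open StateTransition Relation in
theorem storeMachine_run (hkeep : ∀ φ L f, keep (L.map (Edge.map φ)) (f.map φ) ↔ keep L f)
    (hwt : ∀ φ χ χ' L t, (∀ e ∈ L, ∀ b, χ (e.endpoint b) = χ' (φ (e.endpoint b))) →
      wt χ' (L.map (Edge.map φ)) t = wt χ L t) {n : ℕ} {χ : ℕ → Fin k} (σ L : List Edge)
    (c : Fin (K + 1)) (mem : StoreReg K T → ℕ) (hc : L.length = c) (hL : Holds mem L)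
    (hLn : ∀ e ∈ L, ∀ b, 1 ≤ e.endpoint b ∧ e.endpoint b ≤ n)
    (hσn : ∀ e ∈ σ, ∀ b, 1 ≤ e.endpoint b ∧ e.endpoint b ≤ n)
    (hK : (σ.foldl (storeStep keep) L).length ≤ K) :
    ∃ d : (storeMachine K keep wt).Config,
      Reaches ((storeMachine K keep wt).step n χ) ⟨(Phase.reading, c), mem, σ⟩ d ∧
      (storeMachine K keep wt).step n χ d = none ∧
      ∀ t, d.mem (out t) = wt χ (σ.foldl (storeStep keep) L) t := by
  induction σ generalizing L c mem with
  | nil =>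
    refine ⟨⟨(Phase.done, c), fun r => Expr.eval mem (writeExpr
      (weight wt c (fun i j => decide (mem i ≤ mem j))
        (fun i => if 1 ≤ mem i ∧ mem i ≤ n then some (χ (mem i)) else none)) r), []⟩,
      ?_, rfl, fun t => ?_⟩
    · refine ReflTransGen.head (b := ⟨(Phase.writing, c), mem, []⟩) rfl
        (ReflTransGen.single rfl)
    · rw [List.foldl_nil]
      simp only [writeExpr, Expr.eval]
      rw [← hc]
      refine weight_eq hwt hL (by omega) (fun i e he b => ?_) t
      rw [hL i e he b, if_pos (hLn e (List.mem_of_getElem? he) b)]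
  | cons f σ ih =>
    rw [List.foldl_cons] at hK
    set mem' : StoreReg K T → ℕ :=
      Function.update (Function.update mem src f.src) dst f.dst with hmem'
    have hs : mem' src = f.src := by simp [hmem']
    have hd : mem' dst = f.dst := by simp [hmem']
    have hslot : ∀ i b, mem' (slot i b) = mem (slot i b) := fun i b => by simp [hmem']
    have hL' : Holds mem' L := fun i e he b => (hslot i b).trans (hL i e he b)
    have hread : (storeMachine K keep wt).step n χ ⟨(Phase.reading, c), mem, f :: σ⟩ =
        some ⟨(Phase.deciding, c), mem', σ⟩ := rfl
    have hcode := keepCode_iff hkeep hL' (by omega) hs hd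
    have hσn' : ∀ e ∈ σ, ∀ b, 1 ≤ e.endpoint b ∧ e.endpoint b ≤ n :=
      fun e he => hσn e (List.mem_cons_of_mem _ he)
    -- In the branch that stores `f`, this yields `c < K`, so the guard in the program does not
    -- block the assignment.
    have hlen := (length_le_foldl_storeStep keep σ _).trans hK
    by_cases hk : keep L f
    · have hst : storeStep keep L f = L ++ [f] := if_pos hk
      rw [hst, List.length_append, List.length_singleton] at hlen
      have hcK : (c : ℕ) < K := by omega
      have hkc : KeepCode keep c (fun i j => decide (mem' i ≤ mem' j)) ∧ (c : ℕ) < K :=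
        ⟨hc ▸ hcode.2 hk, hcK⟩
      set mem'' : StoreReg K T → ℕ := fun r => Expr.eval mem'
        (if r = slot ⟨c, hcK⟩ false then Expr.reg src
          else if r = slot ⟨c, hcK⟩ true then Expr.reg dst
          else Expr.reg r) with hmem''
      have hdec : (storeMachine K keep wt).step n χ ⟨(Phase.deciding, c), mem', σ⟩ =
          some ⟨(Phase.reading, ⟨c + 1, Nat.succ_lt_succ hcK⟩), mem'', σ⟩ := by
        simp only [StreamMachine.step, storeMachine]
        rw [dif_pos hkc]
      have hL'' : Holds mem'' (L ++ [f]) := by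
        intro i e he b
        by_cases hi : (i : ℕ) = c
        · have hi' : i = ⟨c, hcK⟩ := Fin.ext hi
          have hef : f = e := by
            rw [hi, ← hc, List.getElem?_concat_length] at he
            exact Option.some.inj he
          subst hef hi'
          cases b
          · simpa [hmem'', Expr.eval, Edge.endpoint] using hs
          · simpa [hmem'', Expr.eval, Edge.endpoint] using hd
        · have hilt : (i : ℕ) < L.length := by
            have := (List.getElem?_eq_some_iff.1 he).1
            rw [List.length_append, List.length_singleton] at this
            omega
          rw [List.getElem?_append_left hilt] at he
          have hi' : i ≠ ⟨c, hcK⟩ := fun h => hi (congrArg Fin.val h)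
          rw [← hL' i e he b]
          simp [hmem'', Expr.eval, hi']
      obtain ⟨d, h1, h2, h3⟩ := ih (L ++ [f]) ⟨c + 1, Nat.succ_lt_succ hcK⟩ mem''
        (by simp [hc]) hL'' (fun e he => by
          rcases List.mem_append.1 he with h | h
          · exact hLn e h
          · rw [List.mem_singleton.1 h]
            exact hσn f (by simp)) hσn' (hst ▸ hK)
      refine ⟨d, ReflTransGen.head hread (ReflTransGen.head hdec h1), h2, ?_⟩
      rwa [List.foldl_cons, hst]
    · have hst : storeStep keep L f = L := if_neg hk
      have hdec : (storeMachine K keep wt).step n χ ⟨(Phase.deciding, c), mem', σ⟩ =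
          some ⟨(Phase.reading, c), mem', σ⟩ := by
        simp only [StreamMachine.step, storeMachine]
        rw [dif_neg fun h => hk (hcode.1 (hc ▸ h.1))]
        rfl
      obtain ⟨d, h1, h2, h3⟩ := ih L c mem' hc hL' hLn hσn' (hst ▸ hK)
      refine ⟨d, ReflTransGen.head hread (ReflTransGen.head hdec h1), h2, ?_⟩
      rwa [List.foldl_cons, hst]

-- A register only ever holds zero, `n`, a vertex name, or an output weight. The weights are bounded
-- by `W` independently of `n`, because they depend on finitely many comparison and color patterns.
open StateTransition Relation in
theorem storeMachine_mem_le {W : ℕ} (hW : ∀ (c : Fin (K + 1))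
      (cmp : StoreReg K T → StoreReg K T → Bool)
      (col : StoreReg K T → Option (Fin k)) (t : T), weight wt c cmp col t ≤ W)
    {n : ℕ} {χ : ℕ → Fin k} {σ : List Edge} (hσ : ∀ e ∈ σ, ∀ b, e.endpoint b ≤ n)
    {d : (storeMachine K keep wt).Config}
    (hd : Reaches ((storeMachine K keep wt).step n χ) ((storeMachine K keep wt).init n σ) d) :
    (∀ r, d.mem r ≤ n + W) ∧ ∀ e ∈ d.rest, ∀ b, e.endpoint b ≤ n := by
  induction hd with
  | refl =>
    refine ⟨fun r => ?_, hσ⟩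
    simp only [StreamMachine.init, Function.update_apply]
    split_ifs <;> omega
  | @tail a b _ hab ih =>
    obtain ⟨⟨ph, c⟩, mem, rest⟩ := a
    obtain ⟨h1, h2⟩ := ih
    cases ph with
    | reading =>
      cases rest with
      | nil =>
        obtain rfl : _ = b := Option.some.inj hab
        exact ⟨h1, h2⟩
      | cons f rest =>
        obtain rfl : _ = b := Option.some.inj hab
        refine ⟨fun r => ?_, fun e he => h2 e (List.mem_cons_of_mem _ he)⟩
        have hs : f.src ≤ n := h2 f (by simp) false
        have hd : f.dst ≤ n := h2 f (by simp) true
        simp only [Function.update_apply]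
        split_ifs
        · omega
        · omega
        · exact h1 r
    | deciding =>
      have hab : (storeMachine K keep wt).step n χ ⟨(Phase.deciding, c), mem, rest⟩ = some b := hab
      simp only [StreamMachine.step, storeMachine] at hab
      split_ifs at hab with hk
      · obtain rfl : _ = b := Option.some.inj hab
        refine ⟨fun r => ?_, h2⟩
        simp only
        split_ifs <;> exact h1 _
      · obtain rfl : _ = b := Option.some.inj hab
        exact ⟨fun r => h1 r, h2⟩
    | writing =>
      obtain rfl : _ = b := Option.some.inj hab
      refine ⟨fun r => ?_, h2⟩
      rcases r with r | r | t
      · exact h1 _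
      · exact h1 _
      · exact (hW _ _ _ _).trans (Nat.le_add_left _ _)
    | done => exact absurd hab (Option.not_mem_none b)

/-- The bit length of `n + W` exceeds that of `n` by at most a constant, and for `n ≥ 2` additive
constants are absorbed because `log n ≥ log 2 > 0`. -/
theorem size_add_le (A B W : ℕ) : ∃ C : ℝ, ∀ n : ℕ, 2 ≤ n →
    ((A + B * (n + W).size : ℕ) : ℝ) ≤ C * Real.log n := by
  have hlog2 : 0 < Real.log 2 := Real.log_pos (by norm_num)
  have hsize : ∀ n : ℕ, 2 ≤ n → (n.size : ℝ) ≤ 2 / Real.log 2 * Real.log n := by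
    intro n hn
    have h1 : 2 ^ (n.size - 1) ≤ n := by
      refine Nat.lt_size.1 ?_
      have : 0 < n.size := Nat.size_pos.2 (by omega)
      omega
    have h2 : Real.log 2 ≤ Real.log n := Real.log_le_log (by norm_num) (by exact_mod_cast hn)
    have h3 : ((n.size - 1 : ℕ) : ℝ) * Real.log 2 ≤ Real.log n := by
      rw [← Real.log_pow]
      exact Real.log_le_log (by positivity) (by exact_mod_cast h1)
    have h4 : (n.size : ℝ) ≤ ((n.size - 1 : ℕ) : ℝ) + 1 := by
      have : n.size ≤ n.size - 1 + 1 := by omega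
      exact_mod_cast this
    rw [div_mul_eq_mul_div, le_div_iff₀ hlog2]
    nlinarith
  refine ⟨(A + B * (W + 1).size) / Real.log 2 + B * (2 / Real.log 2), fun n hn => ?_⟩
  have h1 : (n + W).size ≤ n.size + (W + 1).size := by
    rw [Nat.size_le, pow_add]
    have h2 := Nat.lt_size_self n
    have h3 := Nat.lt_size_self (W + 1)
    nlinarith
  have h2 : 1 ≤ Real.log n / Real.log 2 := by
    rw [one_le_div hlog2]
    exact Real.log_le_log (by norm_num) (by exact_mod_cast hn)
  have h3 : ((A + B * (n + W).size : ℕ) : ℝ) ≤ (A + B * (W + 1).size) * 1 + B * n.size := by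
    have : A + B * (n + W).size ≤ (A + B * (W + 1).size) * 1 + B * n.size := by nlinarith
    exact_mod_cast this
  refine h3.trans (le_trans ?_ (le_of_eq (by ring :
    (A + B * (W + 1).size : ℝ) * (Real.log n / Real.log 2) +
      B * (2 / Real.log 2 * Real.log n) = _)))
  exact add_le_add (mul_le_mul_of_nonneg_left h2 (by positivity))
    (mul_le_mul_of_nonneg_left (hsize n hn) (Nat.cast_nonneg _))

open StateTransition in
/-- A one-pass algorithm in logarithmic space from a rule for storing edges that is invariant under
relabelling. -/
theorem exists_storeMachine (K : ℕ)
    (hkeep : ∀ φ L f, keep (L.map (Edge.map φ)) (f.map φ) ↔ keep L f)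
    (hwt : ∀ φ χ χ' L t, (∀ e ∈ L, ∀ b, χ (e.endpoint b) = χ' (φ (e.endpoint b))) →
      wt χ' (L.map (Edge.map φ)) t = wt χ L t) :
    ∃ (M : StreamMachine k T) (C : ℝ), ∀ (n : ℕ) (χ : ℕ → Fin k) (σ : List Edge), 2 ≤ n →
      (∀ e ∈ σ, ∀ b, 1 ≤ e.endpoint b ∧ e.endpoint b ≤ n) → (store keep σ).length ≤ K →
      M.HaltsInSpace n χ σ (C * Real.log n) ∧
      ∃ c ∈ eval (M.step n χ) (M.init n σ), ∀ t, c.mem (M.outReg t) = wt χ (store keep σ) t := by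
  obtain ⟨W, hW⟩ := exists_weight_le K wt
  let M := storeMachine K keep wt
  obtain ⟨C, hC⟩ := size_add_le (Fintype.card M.Q).size (Fintype.card M.R) W
  refine ⟨M, C, fun n χ σ hn hσ hK => ?_⟩
  obtain ⟨d, h1, h2, h3⟩ := storeMachine_run (n := n) (χ := χ) hkeep hwt σ [] (0 : Fin (K + 1))
    (Function.update (fun _ => 0) size n) rfl (fun i e he => by simp at he) (by simp) hσ hK
  have heval : d ∈ eval (M.step n χ) (M.init n σ) := mem_eval.2 ⟨h1, h2⟩
  refine ⟨⟨Part.dom_iff_mem.2 ⟨d, heval⟩, fun c hc => le_trans ?_ (hC n hn)⟩, d, heval, h3⟩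
  have hmem := (storeMachine_mem_le hW (fun e he b => (hσ e he b).2) hc).1
  have : M.space c ≤ (Fintype.card M.Q).size + Fintype.card M.R * (n + W).size := by
    refine Nat.add_le_add_left ?_ _
    refine (Finset.sum_le_card_nsmul _ _ _ fun r _ => Nat.size_le_size (hmem r)).trans ?_
    rw [smul_eq_mul, Finset.card_univ]
  exact_mod_cast this

end

end DicutStream

namespace DicutStream

open DiMultigraph

/-! ### The storage rule -/

/-- Store the first `N` edges, and those in the visible neighborhoods of the first `s` edges. -/
def keepRule (l s N : ℕ) (L : List Edge) (f : Edge) : Prop :=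
  L.length < N ∨ ∃ e ∈ L.take s, Touches l e (visNbhd l e L) f

theorem keepRule_relabel (l s N : ℕ) (φ : Equiv.Perm ℕ) (L : List Edge) (f : Edge) :
    keepRule l s N (L.map (Edge.map φ)) (f.map φ) ↔ keepRule l s N L f := by
  simp only [keepRule, List.length_map, ← List.map_take, List.mem_map, exists_exists_and_eq_and,
    visNbhd_relabel, touches_relabel]

theorem store_append_of_keep {keep : List Edge → Edge → Prop} {σ : List Edge} {f : Edge}
    (h : keep (store keep σ) f) : store keep (σ ++ [f]) = store keep σ ++ [f] := by
  rw [store, List.foldl_append]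
  exact if_pos h

theorem store_append_of_not_keep {keep : List Edge → Edge → Prop} {σ : List Edge} {f : Edge}
    (h : ¬ keep (store keep σ) f) : store keep (σ ++ [f]) = store keep σ := by
  rw [store, List.foldl_append]
  exact if_neg h

section

variable {l s N : ℕ}

theorem store_of_length_le {σ : List Edge} (h : σ.length ≤ N) :
    store (keepRule l s N) σ = σ := by
  induction σ using List.reverseRecOn with
  | nil => rfl
  | append_singleton σ f ih =>
    rw [List.length_append, List.length_singleton] at h
    have ih := ih (by omega)
    rw [store_append_of_keep (Or.inl (by rw [ih]; omega)), ih]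

/-- This guarantees that the first `s` entries of the stored list, to which the rule refers, are the
first `s` edges of the stream itself when `s ≤ N`. -/
theorem take_store (σ : List Edge) : (store (keepRule l s N) σ).take N = σ.take N := by
  induction σ using List.reverseRecOn with
  | nil => rfl
  | append_singleton σ f ih =>
    by_cases h : (σ ++ [f]).length ≤ N
    · rw [store_of_length_le h]
    · rw [List.length_append, List.length_singleton] at h
      have h1 : N ≤ (store (keepRule l s N) σ).length := by
        have := congrArg List.length ih
        rw [List.length_take, List.length_take] at this
        omega
      rw [List.take_append_of_le_length (by omega), ← ih]
      by_cases hk : keepRule l s N (store (keepRule l s N) σ) f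
      · rw [store_append_of_keep hk, List.take_append_of_le_length h1]
      · rw [store_append_of_not_keep hk]

theorem take_store_of_le (hs : s ≤ N) (σ : List Edge) :
    (store (keepRule l s N) σ).take s = σ.take s := by
  have := congrArg (List.take s) (take_store (l := l) (s := s) (N := N) σ)
  rwa [List.take_take, List.take_take, min_eq_left hs] at this

theorem length_le_length_store {σ : List Edge} (h : N ≤ σ.length) :
    N ≤ (store (keepRule l s N) σ).length := by
  have := congrArg List.length (take_store (l := l) (s := s) (N := N) σ)
  rw [List.length_take, List.length_take] at this
  omega

/-- By induction the exploration from `e` is in the same state on the stored list as on the stream,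
so an edge that the rule discards would not have been recorded from `e` either. Nothing that
precedes `e` is lost, as the first `N` edges are all stored. -/
theorem visNbhd_store (hs : s ≤ N) {σ : List Edge} {e : Edge} (he : e ∈ σ.take s) :
    visNbhd l e (store (keepRule l s N) σ) = visNbhd l e σ := by
  induction σ using List.reverseRecOn with
  | nil => rfl
  | append_singleton σ f ih =>
    by_cases h : (σ ++ [f]).length ≤ N
    · rw [store_of_length_le h]
    · rw [List.length_append, List.length_singleton] at h
      rw [List.take_append_of_le_length (by omega)] at he
      have ih := ih he
      by_cases hk : keepRule l s N (store (keepRule l s N) σ) f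
      · rw [store_append_of_keep hk, visNbhd_append, ih, visNbhd_append]
      · rw [store_append_of_not_keep hk, ih, visNbhd_append_of_not_touches]
        intro ht
        exact hk (Or.inr ⟨e, by rwa [take_store_of_le hs], by rwa [ih]⟩)

theorem card_visNbhd_edges_append (l : ℕ) (e : Edge) (σ : List Edge) (f : Edge) :
    Multiset.card (visNbhd l e σ).edges ≤ Multiset.card (visNbhd l e (σ ++ [f])).edges := by
  by_cases h : Touches l e (visNbhd l e σ) f
  · rw [visNbhd_append_of_touches h]
    exact Multiset.card_le_card (Multiset.le_cons_self _ _)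
  · rw [visNbhd_append_of_not_touches h]

/-- Past the first `N` edges, every stored edge enlarges the visible neighborhood of at least one of
the first `s` edges, so the sum of their sizes pays for it. -/
theorem length_store_le (hs : s ≤ N) (σ : List Edge) :
    (store (keepRule l s N) σ).length ≤
      N + ((σ.take s).map fun e => Multiset.card (visNbhd l e σ).edges).sum := by
  induction σ using List.reverseRecOn with
  | nil => simp [store]
  | append_singleton σ f ih =>
    by_cases h : (σ ++ [f]).length ≤ N
    · rw [store_of_length_le h]
      omega
    · rw [List.length_append, List.length_singleton] at h
      rw [List.take_append_of_le_length (by omega)]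
      by_cases hk : keepRule l s N (store (keepRule l s N) σ) f
      · rw [store_append_of_keep hk, List.length_append, List.length_singleton]
        obtain hlt | ⟨e, he, ht⟩ := hk
        · exact absurd (length_le_length_store (l := l) (s := s) (show N ≤ σ.length by omega))
            (by omega)
        rw [take_store_of_le hs] at he
        rw [visNbhd_store hs he] at ht
        have hlt : ((σ.take s).map fun e => Multiset.card (visNbhd l e σ).edges).sum <
            ((σ.take s).map fun e => Multiset.card (visNbhd l e (σ ++ [f])).edges).sum := by
          refine List.sum_lt_sum _ _ (fun e _ => card_visNbhd_edges_append l e σ f) ⟨e, he, ?_⟩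
          rw [visNbhd_append_of_touches ht]
          simp [addEdge]
        omega
      · rw [store_append_of_not_keep hk]
        refine ih.trans (Nat.add_le_add_left (List.sum_le_sum fun e _ => ?_) _)
        exact card_visNbhd_edges_append l e σ f

end

/-! ### The output weights -/

section

open Classical

variable {k l D : ℕ}

/-- The exact distribution if the whole stream has been stored, and otherwise the visible types of
the first `s` edges. -/
noncomputable def weightRule (l s N : ℕ) (χ : ℕ → Fin k) (L : List Edge)
    (t : boundedTypes k l D) : ℕ :=
  if L.length < N then
    (L.map fun e => ((orderings (L : Multiset Edge)).filter fun σ => visType χ σ l e = t).card).sum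
  else (L.take s).countP fun e => visType χ L l e = t

theorem weightRule_relabel (l s N : ℕ) (φ : Equiv.Perm ℕ) (χ χ' : ℕ → Fin k) (L : List Edge)
    (t : boundedTypes k l D) (h : ∀ e ∈ L, ∀ b, χ (e.endpoint b) = χ' (φ (e.endpoint b))) :
    weightRule l s N χ' (L.map (Edge.map φ)) t = weightRule l s N χ L t := by
  have h' : ∀ e ∈ L, χ e.src = χ' (φ e.src) ∧ χ e.dst = χ' (φ e.dst) :=
    fun e he => ⟨h e he false, h e he true⟩
  simp only [weightRule, List.length_map]
  split_ifs with hlt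
  · rw [List.map_map]
    refine congrArg List.sum (List.map_congr_left fun e he => ?_)
    rw [Function.comp_apply, ← Multiset.map_coe, orderings_map, Finset.filter_image,
      Finset.card_image_of_injective _ (List.map_injective_iff.2 (Edge.map_injective φ))]
    congr 1
    refine Finset.filter_congr fun σ hσ => ?_
    rw [visType_relabel φ χ χ' l e σ (h' e he) fun f hf =>
      h' f ((mem_of_mem_orderings hσ).1 hf)]
  · rw [← List.map_take, List.countP_map]
    refine List.countP_congr fun e he => ?_
    rw [Function.comp_apply, visType_relabel φ χ χ' l e L (h' e (List.mem_of_mem_take he)) h']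

variable {G : DiMultigraph} {χ : ℕ → Fin k}

/-- Counting pairs of an edge and an ordering clears the denominators: the integer weights are the
exact probabilities times a factor that does not depend on `t`. -/
theorem weightRule_of_lt {N : ℕ} (s : ℕ) {σ : List Edge} (hσ : σ ∈ orderings G.edges)
    (hN : Multiset.card G.edges < N) (hE : G.edges ≠ 0) (t : boundedTypes k l D) :
    (weightRule l s N χ σ t : ℝ) =
      Multiset.card G.edges * (orderings G.edges).card * typeProb G χ l (t : GraphType k) := by
  have hm : (Multiset.card G.edges : ℝ) ≠ 0 := by simpa using hE
  have hcard : ∀ e, (((orderings G.edges).filter fun σ => visType χ σ l e = t).card : ℝ) =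
      visProb G χ l (t : GraphType k) e * (orderings G.edges).card := by
    intro e
    rw [← sum_visType_indicator, sum_ind]
    congr!
  have hfin : σ.toFinset = G.edges.toFinset := by
    ext e
    simp [mem_of_mem_orderings hσ]
  rw [weightRule, if_pos (by rwa [orderings_length hσ]), mem_orderings.1 hσ,
    Finset.sum_list_map_count, hfin, typeProb, mul_div_assoc', mul_assoc,
    mul_div_cancel_left₀ _ hm, Finset.mul_sum]
  push_cast
  refine Finset.sum_congr rfl fun e _ => ?_
  rw [nsmul_eq_mul, Nat.cast_mul, hcard, Nat.cast_id, count_of_mem_orderings hσ]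
  ring

theorem countP_take (σ : List Edge) (s : ℕ) (P : Edge → Bool) :
    ((σ.take s).countP P : ℝ) =
      ∑ i ∈ Finset.range s, ind (∃ a, σ[i]? = some a ∧ P a = true) := by
  induction σ generalizing s with
  | nil => simp [ind]
  | cons b σ ih =>
    cases s with
    | zero => simp
    | succ s =>
      rw [List.take_succ_cons, List.countP_cons, Finset.sum_range_succ']
      push_cast
      rw [ih]
      simp [ind]

theorem weightRule_of_le {s N : ℕ} (hs : s ≤ N) (hs0 : 1 ≤ s) {σ : List Edge} (hN : N ≤ σ.length)
    (t : boundedTypes k l D) :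
    (weightRule l s N χ (store (keepRule l s N) σ) t : ℝ) = s * freq χ l (t : GraphType k) s σ := by
  rw [weightRule, if_neg (not_lt.2 (length_le_length_store hN)), freq,
    mul_div_cancel₀ _ (by positivity), take_store_of_le hs]
  have hcount : ((σ.take s).countP fun e => visType χ (store (keepRule l s N) σ) l e = t) =
      (σ.take s).countP fun e => visType χ σ l e = t := by
    refine List.countP_congr fun e he => ?_
    rw [decide_eq_true_iff, decide_eq_true_iff, visType, visNbhd_store hs he, visType]
  rw [hcount, countP_take]
  simp only [decide_eq_true_eq]
  rfl

theorem sum_ind_subtype {α : Type*} {S : Set α} [Fintype S] {x : α} (hx : x ∈ S) :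
    ∑ t : S, ind (x = t) = 1 := by
  rw [Finset.sum_eq_single ⟨x, hx⟩]
  · simp [ind]
  · intro t _ ht
    exact if_neg fun h => ht (Subtype.ext h.symm)
  · simp

theorem typeProb_eq_zero (hG : G.IsBounded D) (hχ : G.IsProperColoring χ) (hl : 1 ≤ l)
    {T : GraphType k} (hT : T ∉ boundedTypes k l D) : typeProb G χ l T = 0 := by
  rw [typeProb, Finset.sum_eq_zero, zero_div]
  intro e he
  rw [visProb, Finset.sum_eq_zero, zero_div, mul_zero]
  intro σ hσ
  have hmem := typeOf_visNbhd_mem_boundedTypes hG hχ hl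
    ((mem_of_mem_orderings hσ).2 (Multiset.mem_toFinset.1 he)) (mem_orderings.1 hσ).le
  exact if_neg fun h : visType χ σ l e = T => hT (h ▸ hmem)

variable [Fintype (boundedTypes k l D)]

theorem sum_visProb (hG : G.IsBounded D) (hχ : G.IsProperColoring χ) (hl : 1 ≤ l) {e : Edge}
    (he : e ∈ G.edges) : ∑ t : boundedTypes k l D, visProb G χ l (t : GraphType k) e = 1 := by
  simp only [visProb]
  rw [← Finset.sum_div, Finset.sum_comm, Finset.sum_congr rfl fun σ hσ => sum_ind_subtype
    (typeOf_visNbhd_mem_boundedTypes hG hχ hl ((mem_of_mem_orderings hσ).2 he)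
      (mem_orderings.1 hσ).le)]
  rw [Finset.sum_const, nsmul_eq_mul, mul_one, div_self (card_orderings_pos _).ne']

theorem sum_typeProb (hG : G.IsBounded D) (hχ : G.IsProperColoring χ) (hl : 1 ≤ l)
    (hE : G.edges ≠ 0) : ∑ t : boundedTypes k l D, typeProb G χ l (t : GraphType k) = 1 := by
  simp only [typeProb]
  rw [← Finset.sum_div, Finset.sum_comm, Finset.sum_congr rfl fun e he => by
    rw [← Finset.mul_sum, sum_visProb hG hχ hl (Multiset.mem_toFinset.1 he), mul_one],
    sum_count_toFinset, div_self]
  simpa using hE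

theorem sum_freq (hG : G.IsBounded D) (hχ : G.IsProperColoring χ) (hl : 1 ≤ l) {s : ℕ}
    (hs : 1 ≤ s) (hsm : s ≤ Multiset.card G.edges) {σ : List Edge} (hσ : σ ∈ orderings G.edges) :
    ∑ t : boundedTypes k l D, freq χ l (t : GraphType k) s σ = 1 := by
  simp only [freq]
  have hone : ∀ i ∈ Finset.range s, ∑ t : boundedTypes k l D, hit χ l (t : GraphType k) i σ = 1 := by
    intro i hi
    have hi' : i < σ.length := by
      rw [orderings_length hσ]
      exact (Finset.mem_range.1 hi).trans_le hsm
    rw [← sum_ind_subtype (typeOf_visNbhd_mem_boundedTypes hG hχ hl (List.getElem_mem hi')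
      (mem_orderings.1 hσ).le)]
    simp [hit, List.getElem?_eq_getElem hi']
  rw [← Finset.sum_div, Finset.sum_comm, Finset.sum_congr rfl hone, Finset.sum_const,
    Finset.card_range, nsmul_eq_mul, mul_one, div_self (by positivity)]

end

/-! ### Distributions -/

theorem exists_pmf_of_weights {S : Type} [Fintype S] (w : S → ℕ) (P : S → ℝ) {c : ℝ} (hc : 0 < c)
    (hw : ∀ t, (w t : ℝ) = c * P t) (hP : ∑ t, P t = 1) :
    ∃ Q : PMF S, (∀ t, Q t = (w t : ENNReal) / ∑' t', (w t' : ENNReal)) ∧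
      ∀ t, (Q t).toReal = P t := by
  have hsum : ((∑ t, w t : ℕ) : ℝ) = c := by
    push_cast
    rw [Finset.sum_congr rfl fun t _ => hw t, ← Finset.mul_sum, hP, mul_one]
  have htsum : ∑' t, (w t : ENNReal) = ((∑ t, w t : ℕ) : ENNReal) := by
    rw [tsum_fintype]
    push_cast
    rfl
  have h0 : ∑' t, (w t : ENNReal) ≠ 0 := by
    rw [htsum]
    intro h
    rw [Nat.cast_eq_zero] at h
    rw [h, Nat.cast_zero] at hsum
    exact hc.ne hsum
  have htop : ∑' t, (w t : ENNReal) ≠ ⊤ := by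
    rw [htsum]
    exact ENNReal.natCast_ne_top _
  refine ⟨PMF.normalize (fun t => (w t : ENNReal)) h0 htop, fun t => ?_, fun t => ?_⟩
  · rw [PMF.normalize_apply, div_eq_mul_inv]
  · rw [PMF.normalize_apply, ENNReal.toReal_mul, ENNReal.toReal_inv, htsum, ENNReal.toReal_natCast,
      ENNReal.toReal_natCast, hsum, hw, mul_comm c, mul_assoc, mul_inv_cancel₀ hc.ne', mul_one]

/-- Both distributions vanish off `S`, so the infinite sum reduces to a finite one, ready for a
union bound. -/
theorem tvDist_map_val {α : Type} {S : Set α} [Fintype S] (Q : PMF S) (R : PMF α)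
    (hR : ∀ a ∉ S, R a = 0) :
    tvDist (Q.map Subtype.val) R = 1 / 2 * ∑ t : S, |(Q t).toReal - (R t).toReal| := by
  have hval : ∀ t : S, (Q.map Subtype.val) (t : α) = Q t := by
    intro t
    rw [PMF.map_apply, tsum_eq_single t]
    · simp
    · intro u hu
      exact if_neg fun h => hu (Subtype.ext h.symm)
  have hoff : ∀ a ∉ S, (Q.map Subtype.val) a = 0 := by
    intro a ha
    rw [PMF.map_apply, ENNReal.tsum_eq_zero]
    exact fun u => if_neg fun h : a = u => ha (h ▸ u.2)
  rw [tvDist, ← tsum_subtype_eq_of_support_subset (s := S), tsum_fintype]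
  · simp only [hval]
  · intro a ha
    by_contra h
    rw [Function.mem_support, hoff a h, hR a h] at ha
    simp at ha

end DicutStream

/-! ### Choice of constants and assembly -/

open DicutStream in
theorem mainTheorem7 (k l D : ℕ) (hl : 1 ≤ l) (ε δ : ℝ) (hε : 0 < ε) (hδ : 0 < δ) :
    ∃ (M : DicutStream.StreamMachine k (DicutStream.boundedTypes k l D)) (C : ℝ),
      ∀ (n : ℕ) (G : DicutStream.DiMultigraph) (χ : ℕ → Fin k),
        G.verts = Finset.Icc 1 n → G.IsBounded D → G.IsProperColoring χ →
        ∀ hE : G.edges ≠ 0,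
          ∃ out : List DicutStream.Edge → PMF (DicutStream.boundedTypes k l D),
            (∀ σ ∈ DicutStream.orderings G.edges,
              M.HaltsInSpace n χ σ (C * Real.log n) ∧ M.Outputs n χ σ (out σ)) ∧
            (DicutStream.uniformOrdering G.edges).toOuterMeasure
              {σ | ε < DicutStream.tvDist ((out σ).map Subtype.val)
                (DicutStream.edgeVisDist G χ l hE)} ≤ ENNReal.ofReal δ := by
  classical
  have := Fintype.ofFinite (boundedTypes k l D)
  obtain ⟨B, hB⟩ : ∃ B : ℝ, B = Fintype.card (boundedTypes k l D) := ⟨_, rfl⟩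
  have hB0 : 0 ≤ B := hB ▸ Nat.cast_nonneg _
  -- If each of the `B` frequencies is off by at most `η`, the total variation distance is at most
  -- `B * η / 2 ≤ ε`. Here and below, `B + 1` avoids division by zero.
  set η : ℝ := 2 * ε / (B + 1) with hη
  have hη0 : 0 < η := by positivity
  -- A variance of at most `τ` gives each type failure probability `τ / η ^ 2 = δ / (B + 1)` by
  -- Chebyshev, hence at most `δ` in total. Half of `τ` is spent on 1/s and half on the covariance
  -- term.
  set τ : ℝ := δ * η ^ 2 / (B + 1) with hτ
  have hτ0 : 0 < τ := by positivity
  set κ : ℝ := 1 + 2 * (D + 1) ^ l * (D + 1) ^ l * D with hκ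
  have hκ0 : 0 < κ := by positivity
  obtain ⟨s, hs⟩ := exists_nat_gt (2 / τ)
  have hs0 : 1 ≤ s := Nat.cast_pos.1 ((by positivity : 0 < 2 / τ).trans hs)
  obtain ⟨N₀, hN₀⟩ := exists_nat_gt (2 * κ / τ)
  -- With at least `N` edges, the sample fits into the stream, there are at least two edges, and `m
  -- - 1 ≥ N₀` makes the covariance term at most `τ / 2`.
  set N := s + 2 + N₀ with hN
  have hsN : s ≤ N := by omega
  obtain ⟨M, C, hM⟩ := exists_storeMachine (keep := keepRule l s N)
    (wt := weightRule (k := k) (D := D) l s N)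
    (N + s * (2 * (D + 1) ^ l * D)) (keepRule_relabel l s N) (weightRule_relabel l s N)
  refine ⟨M, C, fun n G χ hV hG hχ hE => ?_⟩
  have hbound : ∀ e ∈ G.edges, ∀ b, 1 ≤ e.endpoint b ∧ e.endpoint b ≤ n := by
    intro e he b
    rw [← Finset.mem_Icc, ← hV]
    cases b
    · exact G.src_mem e he
    · exact G.dst_mem e he
  have hn : 2 ≤ n := by
    obtain ⟨e, he⟩ := Multiset.exists_mem_of_ne_zero hE
    have h1 : 1 ≤ e.src ∧ e.src ≤ n := hbound e he false
    have h2 : 1 ≤ e.dst ∧ e.dst ≤ n := hbound e he true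
    have := e.ne
    omega
  set p : boundedTypes k l D → ℝ := fun t => typeProb G χ l (t : GraphType k) with hp
  set P : List Edge → boundedTypes k l D → ℝ := fun σ t =>
    if Multiset.card G.edges < N then p t else freq χ l (t : GraphType k) s σ with hP
  have hrun : ∀ σ ∈ orderings G.edges, ∃ Q : PMF (boundedTypes k l D),
      M.HaltsInSpace n χ σ (C * Real.log n) ∧ M.Outputs n χ σ Q ∧ ∀ t, (Q t).toReal = P σ t := by
    intro σ hσ
    have hmem : ∀ f ∈ σ, f ∈ G.edges := fun f hf => (mem_of_mem_orderings hσ).1 hf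
    have hlen : (store (keepRule l s N) σ).length ≤ N + s * (2 * (D + 1) ^ l * D) := by
      refine (length_store_le hsN σ).trans (Nat.add_le_add_left ?_ _)
      refine (List.sum_le_card_nsmul _ (2 * (D + 1) ^ l * D) ?_).trans ?_
      · intro x hx
        obtain ⟨e, he, rfl⟩ := List.mem_map.1 hx
        exact card_visNbhd_edges_le hG hl (hmem e (List.mem_of_mem_take he))
          (mem_orderings.1 hσ).le
      · rw [smul_eq_mul, List.length_map]
        exact Nat.mul_le_mul_right _ (List.length_take_le _ _)
    obtain ⟨h1, c, hc, hcw⟩ := hM n χ σ hn (fun e he => hbound e (hmem e he)) hlen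
    have key : ∃ a : ℝ, 0 < a ∧ (∀ t, (c.mem (M.outReg t) : ℝ) = a * P σ t) ∧
        ∑ t, P σ t = 1 := by
      by_cases hm : Multiset.card G.edges < N
      · simp only [hP, if_pos hm]
        refine ⟨Multiset.card G.edges * (orderings G.edges).card,
          mul_pos (Nat.cast_pos.2 (Multiset.card_pos.2 hE)) (card_orderings_pos _), fun t => ?_,
          sum_typeProb hG hχ hl hE⟩
        rw [hcw, store_of_length_le (by rw [orderings_length hσ]; omega)]
        exact weightRule_of_lt s hσ hm hE t
      · simp only [hP, if_neg hm]
        refine ⟨s, Nat.cast_pos.2 hs0, fun t => ?_, sum_freq hG hχ hl hs0 (by omega) hσ⟩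
        rw [hcw]
        exact weightRule_of_le hsN hs0 (by rw [orderings_length hσ]; omega) t
    obtain ⟨a, ha, hw, hsum⟩ := key
    obtain ⟨Q, hQ, hQP⟩ := exists_pmf_of_weights (fun t => c.mem (M.outReg t)) (P σ) ha hw hsum
    exact ⟨Q, h1, ⟨c, hc, hQ⟩, hQP⟩
  obtain ⟨σ₀, hσ₀⟩ := orderings_nonempty G.edges
  -- `out` must be defined on all lists; off the orderings of `G` any distribution will do, and the
  -- one for `σ₀` is used.
  have hrun' : ∀ σ, ∃ Q : PMF (boundedTypes k l D), σ ∈ orderings G.edges →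
      M.HaltsInSpace n χ σ (C * Real.log n) ∧ M.Outputs n χ σ Q ∧
        ∀ t, (Q t).toReal = P σ t := by
    intro σ
    by_cases hσ : σ ∈ orderings G.edges
    · exact (hrun σ hσ).imp fun Q hQ _ => hQ
    · exact ⟨(hrun σ₀ hσ₀).choose, fun h => absurd h hσ⟩
  choose out hout using hrun'
  refine ⟨out, fun σ hσ => ⟨(hout σ hσ).1, (hout σ hσ).2.1⟩, ?_⟩
  have htv : ∀ σ ∈ orderings G.edges, tvDist ((out σ).map Subtype.val) (edgeVisDist G χ l hE) =
      1 / 2 * ∑ t, |P σ t - p t| := by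
    intro σ hσ
    rw [tvDist_map_val]
    · simp only [(hout σ hσ).2.2, edgeVisDist_toReal hl hE, hp]
    · intro T hT
      have := typeProb_eq_zero hG hχ hl hT
      rw [← edgeVisDist_toReal hl hE, ENNReal.toReal_eq_zero_iff] at this
      exact this.resolve_right (PMF.apply_ne_top _ _)
  rw [uniformOrdering, PMF.toOuterMeasure_uniformOfFinset_apply]
  refine ENNReal.div_le_of_le_mul ?_
  rw [← ENNReal.ofReal_natCast (Finset.card (orderings G.edges)), ← ENNReal.ofReal_mul hδ.le,
    ← ENNReal.ofReal_natCast]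
  refine ENNReal.ofReal_le_ofReal ?_
  by_cases hm : Multiset.card G.edges < N
  · rw [Finset.filter_false_of_mem]
    · simp only [Finset.card_empty, Nat.cast_zero]
      positivity
    · intro σ hσ h
      rw [Set.mem_ofPred_eq, htv σ hσ] at h
      simp only [hP, if_pos hm, sub_self, abs_zero, Finset.sum_const_zero, mul_zero] at h
      exact absurd h hε.not_gt
  -- Union bound: if no single type deviates by more than `η`, the total variation distance cannot
  -- exceed `ε`.
  · have hsub : ((orderings G.edges).filter fun σ => σ ∈ {σ | ε < tvDist ((out σ).map Subtype.val)
        (edgeVisDist G χ l hE)}) ⊆ Finset.univ.biUnion fun t : boundedTypes k l D =>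
        (orderings G.edges).filter fun σ => η < |freq χ l (t : GraphType k) s σ -
          typeProb G χ l (t : GraphType k)| := by
      intro σ hσ
      obtain ⟨hσ, h⟩ := Finset.mem_filter.1 hσ
      rw [Set.mem_ofPred_eq, htv σ hσ] at h
      simp only [hP, if_neg hm] at h
      by_contra hcon
      have hle : ∀ t : boundedTypes k l D, |freq χ l (t : GraphType k) s σ - p t| ≤ η := by
        intro t
        by_contra ht
        exact hcon (Finset.mem_biUnion.2 ⟨t, Finset.mem_univ _,
          Finset.mem_filter.2 ⟨hσ, not_le.1 ht⟩⟩)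
      have hsum := Finset.sum_le_card_nsmul Finset.univ _ η fun t _ => hle t
      rw [Finset.card_univ, nsmul_eq_mul, ← hB] at hsum
      have : B * η ≤ 2 * ε := by
        rw [hη, mul_div_assoc', div_le_iff₀ (by positivity)]
        nlinarith
      linarith
    have hm2 : 2 ≤ Multiset.card G.edges := by omega
    have hsm : s ≤ Multiset.card G.edges := by omega
    have hNm : (N₀ : ℝ) ≤ Multiset.card G.edges - 1 := by
      have : N₀ + 1 ≤ Multiset.card G.edges := by omega
      have : (N₀ : ℝ) + 1 ≤ Multiset.card G.edges := by exact_mod_cast this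
      linarith
    have hN₀0 : (0 : ℝ) < N₀ := (by positivity : 0 < 2 * κ / τ).trans hN₀
    have hτs : 1 / (s : ℝ) + κ / (Multiset.card G.edges - 1) ≤ τ := by
      have h1 : 1 / (s : ℝ) ≤ τ / 2 := by
        rw [div_lt_iff₀ hτ0] at hs
        rw [div_le_iff₀ (Nat.cast_pos.2 hs0)]
        nlinarith
      have h2 : κ / (Multiset.card G.edges - 1) ≤ τ / 2 := by
        rw [div_lt_iff₀ hτ0] at hN₀
        rw [div_le_iff₀ (by linarith)]
        nlinarith
      linarith
    calc _ ≤ ∑ t : boundedTypes k l D, (((orderings G.edges).filter fun σ =>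
          η < |freq χ l (t : GraphType k) s σ - typeProb G χ l (t : GraphType k)|).card : ℝ) := by
          exact_mod_cast (Finset.card_le_card hsub).trans Finset.card_biUnion_le
      _ ≤ ∑ _t : boundedTypes k l D, (orderings G.edges).card * (τ / η ^ 2) := by
          refine Finset.sum_le_sum fun t _ => (card_freq_far_le hl hG hm2 hs0 hsm hη0).trans ?_
          exact mul_le_mul_of_nonneg_left (div_le_div_of_nonneg_right hτs (by positivity))
            (Nat.cast_nonneg _)
      _ = B * ((orderings G.edges).card * (τ / η ^ 2)) := by
          rw [Finset.sum_const, Finset.card_univ, nsmul_eq_mul, ← hB]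
      _ ≤ δ * (orderings G.edges).card := by
          have : τ / η ^ 2 = δ / (B + 1) := by
            rw [hτ]
            field_simp
          rw [this]
          have h1 : B * (δ / (B + 1)) ≤ δ := by
            rw [mul_div_assoc', div_le_iff₀ (by positivity)]
            nlinarith
          have h2 := mul_le_mul_of_nonneg_right h1 (card_orderings_pos G.edges).le
          linarith
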